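/- Let $A=(A_{ij})_{i,j=0}^{\ell}$ be an indecomposable generalised Cartan matrix of affine type, with marks $a_i$ and comarks $\check a_i$ (the positive relatively prime integers with $\sum_j A_{ij}a_j=0$ and $\sum_i\check a_iA_{ij}=0$), and suppose $a_0=\check a_0=1$; all untwisted affine types are included. Put $h^\vee=\sum_i\check a_i$. Let $\mathfrak h$ be the Cartan subalgebra of $\mathfrak g(A)$, a complex vector space of dimension $\ell+2$, with simple roots $\alpha_i\in\mathfrak h^*$ and simple coroots $\check\alpha_i\in\mathfrak h$, each family linearly independent, and $\langle\alpha_j,\check\alpha_i\rangle=A_{ij}$. Fix $\mathsf d\in\mathfrak h$ with $\langle\alpha_i,\mathsf d\rangle=\delta_{i,0}$. Let $(\cdot|\cdot)$ be the symmetric bilinear form on $\mathfrak h$ with $(\check\alpha_i|x)=a_i\check a_i^{-1}\langle\alpha_i,x\rangle$ and $(\mathsf d|\mathsf d)=0$, transported to $\mathfrak h^*$ by the isomorphism $\mathfrak h\to\mathfrak h^*$ that it induces. Let $\rho\in\mathfrak h^*$ be the element with $\langle\rho,\check\alpha_i\rangle=1$ for all $i$ and $(\rho|\rho)=0$, and let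 $\delta=\sum_ia_i\alpha_i$. Let ${}^L\mathfrak g$ be the Langlands dual affine Kac–Moody algebra $\mathfrak g({}^tA)$: it is generated by its Cartan subalgebra ${}^L\mathfrak h=\mathfrak h^*$ and by $\check e_i,\check f_i$ $(0\le i\le\ell)$, subject to $[x,x']=0$, $[x,\check e_i]=\langle x,\check\alpha_i\rangle\check e_i$, $[x,\check f_i]=-\langle x,\check\alpha_i\rangle\check f_i$, $[\check e_i,\check f_j]=\delta_{ij}\alpha_i$ for $x,x'\in\mathfrak h^*$, and to the Serre relations $(\mathrm{ad}\,\check e_i)^{1-A_{ji}}\check e_j=0=(\mathrm{ad}\,\check f_i)^{1-A_{ji}}\check f_j$ for $i\ne j$. Let ${}^L\mathfrak g=\bigoplus_n{}^L\mathfrak g_n$ be its principal gradation ($\deg\check e_i=1$, $\deg\check f_i=-1$, $\deg{}^L\mathfrak h=0$). Set $p_{-1}=\sum_i\check f_i$ and $p_1=\sum_ia_i\check e_i$, and for $n\ge1$ let $\mathfrak a_n=\{x\in{}^L\mathfrak g_n:[p_{-1},x]\in\mathbb C\delta\}$ be the degree-$n$ part of the principal subalgebra. Let $\mathcal M=\mathbb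 C(z)$ be the field of meromorphic functions on $\mathbb P^1$. Consider connections $\nabla=d+p_{-1}dz+b\,dz$ with $b=\sum_{n\ge0}b_n$ a possibly infinite sum, $b_n\in{}^L\mathfrak g_n\otimes\mathcal M$. For $g=\exp(m)$ with $m=\sum_{n>0}m_n$, $m_n\in{}^L\mathfrak g_n\otimes\mathcal M$, the gauge transformation by $g$ sends $d+X\,dz$ to $d+gXg^{-1}dz-(dg)g^{-1}$, where $gXg^{-1}=\sum_{k\ge0}\frac1{k!}\mathrm{ad}_m^kX$ and $(dg)g^{-1}=\sum_{k\ge1}\frac1{k!}\mathrm{ad}_m^{k-1}dm$. The oper $[\nabla]$ underlying $\nabla$ is the orbit of $\nabla$ under these transformations. A quasi-canonical form of $[\nabla]$ is an element of this orbit of the form $d+p_{-1}dz-\frac{\varphi}{h^\vee}\rho\,dz+\sum_{n\ge1}a_n\,dz$ with $\varphi\in\mathcal M$ and $a_n\in\mathfrak a_n\otimes\mathcal M$. The space $\mathfrak a_1$ is spanned by $p_1\neq0$, so that the coefficient of $p_1$, that is, the $v_1\in\mathcal M$ with $a_1=v_1p_1$, is well defined. Let $N,m\ge0$, let $z_1,\dots,z_N,w_1,\dots,w_m\in\mathbb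 C$ be pairwise distinct, let $\lambda_1,\dots,\lambda_N\in\mathfrak h^*$ and $c:\{1,\dots,m\}\to\{0,\dots,\ell\}$, and consider the Miura oper $$\nabla=d+p_{-1}dz-\sum_{i=1}^N\frac{\lambda_i}{z-z_i}dz+\sum_{j=1}^m\frac{\alpha_{c(j)}}{z-w_j}dz .$$ Let $\Phi$ be any branch, near the point $(z_1,\dots,z_N,w_1,\dots,w_m)$, of the multivalued master function $$\Phi=\sum_{1\le i<j\le N}(\lambda_i|\lambda_j)\log(z_i-z_j)-\sum_{i=1}^N\sum_{j=1}^m(\lambda_i|\alpha_{c(j)})\log(z_i-w_j)+\sum_{1\le i<j\le m}(\alpha_{c(i)}|\alpha_{c(j)})\log(w_i-w_j).$$ **Theorem.** The coefficient of $p_1$ in any quasi-canonical form of the oper $[\nabla]$ underlying this Miura oper is $$\frac1{h^\vee}\Bigg(\sum_{i=1}^N\frac{\frac12(\lambda_i|\lambda_i+2\rho)}{(z-z_i)^2}+\sum_{i=1}^N\frac{\partial\Phi/\partial z_i}{z-z_i}+\sum_{j=1}^m\frac{\partial\Phi/\partial w_j}{z-w_j}\Bigg).$$ -/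

import Mathlib

open scoped TensorProduct Topology
open Module (Dual)

noncomputable section

namespace AffineOper

/-- An indecomposable generalised Cartan matrix `A` of affine type, indexed by `{0, …, ℓ}`, together
with its marks `a_i` and comarks `ǎ_i`: the positive, relatively prime integers spanning the null
spaces of `A` and of its transpose. The node `0` satisfies `a_0 = ǎ_0 = 1`. -/
structure AffineCartanMatrix (ℓ : ℕ) where
  A : Matrix (Fin (ℓ + 1)) (Fin (ℓ + 1)) ℤ
  diag : ∀ i, A i i = 2
  off_diag : ∀ i j, i ≠ j → A i j ≤ 0
  zero_iff : ∀ i j, A i j = 0 ↔ A j i = 0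
  indecomposable : ∀ s : Set (Fin (ℓ + 1)), s.Nonempty → sᶜ.Nonempty →
    ∃ i ∈ s, ∃ j ∈ sᶜ, A i j ≠ 0
  /-- the marks `a_i` -/
  mark : Fin (ℓ + 1) → ℕ
  /-- the comarks `ǎ_i` -/
  comark : Fin (ℓ + 1) → ℕ
  mark_pos : ∀ i, 0 < mark i
  comark_pos : ∀ i, 0 < comark i
  gcd_mark : Finset.univ.gcd mark = 1
  gcd_comark : Finset.univ.gcd comark = 1
  mul_mark : ∀ i, ∑ j, A i j * (mark j : ℤ) = 0
  comark_mul : ∀ j, ∑ i, (comark i : ℤ) * A i j = 0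
  mark_zero : mark 0 = 1
  comark_zero : comark 0 = 1

/-- The dual Coxeter number `h^∨ = ∑ ǎ_i`. -/
def AffineCartanMatrix.dualCoxeter {ℓ : ℕ} (C : AffineCartanMatrix ℓ) : ℕ := ∑ i, C.comark i

/-- A realisation of `A`: the Cartan subalgebra `𝔥` of `𝔤(A)`, of dimension `ℓ + 2`, with its simple
roots `α_i ∈ 𝔥*` and simple coroots `α̌_i ∈ 𝔥`, and a choice of `d ∈ 𝔥` with `⟨α_i, d⟩ = δ_{i,0}`. -/
structure Realization {ℓ : ℕ} (C : AffineCartanMatrix ℓ) (𝔥 : Type*) [AddCommGroup 𝔥]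
    [Module ℂ 𝔥] where
  finrank_eq : Module.finrank ℂ 𝔥 = ℓ + 2
  root : Fin (ℓ + 1) → Dual ℂ 𝔥
  coroot : Fin (ℓ + 1) → 𝔥
  linearIndependent_root : LinearIndependent ℂ root
  linearIndependent_coroot : LinearIndependent ℂ coroot
  root_coroot : ∀ i j, root j (coroot i) = (C.A i j : ℂ)
  d : 𝔥
  root_d : ∀ i, root i d = if i = 0 then 1 else 0

namespace Realization

variable {ℓ : ℕ} {C : AffineCartanMatrix ℓ} {𝔥 : Type*} [AddCommGroup 𝔥] [Module ℂ 𝔥]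
  (R : Realization C 𝔥)

/-! ### The normalised bilinear form -/

/-- The imaginary root `δ = ∑ a_i α_i`. -/
def delta : Dual ℂ 𝔥 := ∑ i, (C.mark i : ℂ) • R.root i

/-- The central element `k = ∑ ǎ_i α̌_i`. -/
def central : 𝔥 := ∑ i, (C.comark i : ℂ) • R.coroot i

theorem delta_coroot (i : Fin (ℓ + 1)) : R.delta (R.coroot i) = 0 := by
  have h := C.mul_mark i
  have h' : ((∑ j, C.A i j * (C.mark j : ℤ) : ℤ) : ℂ) = 0 := by rw [h]; simp
  push_cast at h'
  simp only [delta, LinearMap.sum_apply, LinearMap.smul_apply, R.root_coroot, smul_eq_mul]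
  rw [← h']
  exact Finset.sum_congr rfl fun j _ => mul_comm _ _

theorem delta_d : R.delta R.d = 1 := by
  simp [delta, R.root_d, C.mark_zero]

theorem root_central (j : Fin (ℓ + 1)) : R.root j R.central = 0 := by
  have h := C.comark_mul j
  have h' : ((∑ i, (C.comark i : ℤ) * C.A i j : ℤ) : ℂ) = 0 := by rw [h]; simp
  push_cast at h'
  simpa [central, R.root_coroot] using h'

/-- The family `{d} ∪ {α̌_i}`. -/
def cartanFamily : Option (Fin (ℓ + 1)) → 𝔥 := fun o => o.elim R.d R.coroot

theorem linearIndependent_cartanFamily : LinearIndependent ℂ R.cartanFamily := by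
  rw [linearIndependent_option]
  refine ⟨R.linearIndependent_coroot, fun hmem => ?_⟩
  have hle : Submodule.span ℂ (Set.range (R.cartanFamily ∘ some)) ≤ LinearMap.ker R.delta := by
    rw [Submodule.span_le]
    rintro _ ⟨i, rfl⟩
    exact R.delta_coroot i
  have h0 : R.delta R.d = 0 := hle hmem
  rw [R.delta_d] at h0
  exact one_ne_zero h0

/-- The basis `{d} ∪ {α̌_i}` of `𝔥`. -/
def cartanBasis : Module.Basis (Option (Fin (ℓ + 1))) ℂ 𝔥 :=
  basisOfLinearIndependentOfCardEqFinrank R.linearIndependent_cartanFamily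
    (by rw [R.finrank_eq]; simp)

theorem cartanBasis_some (i : Fin (ℓ + 1)) : R.cartanBasis (some i) = R.coroot i := by
  simp [cartanBasis, cartanFamily]

theorem cartanBasis_none : R.cartanBasis none = R.d := by
  simp [cartanBasis, cartanFamily]

/-- The bilinear form `(·|·)` on `𝔥` with `(α̌_i | x) = a_i ǎ_i⁻¹ ⟨α_i, x⟩`,
`(d | α̌_i) = a_i ǎ_i⁻¹ ⟨α_i, d⟩` and `(d | d) = 0`. -/
def form : 𝔥 →ₗ[ℂ] Dual ℂ 𝔥 :=
  R.cartanBasis.constr ℂ fun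
    | some i => ((C.mark i : ℂ) / C.comark i) • R.root i
    | none => R.cartanBasis.constr ℂ fun
      | some i => ((C.mark i : ℂ) / C.comark i) * R.root i R.d
      | none => 0

theorem form_coroot (i : Fin (ℓ + 1)) (x : 𝔥) :
    R.form (R.coroot i) x = ((C.mark i : ℂ) / C.comark i) * R.root i x := by
  rw [← R.cartanBasis_some, form, Module.Basis.constr_basis]
  simp

theorem form_d_coroot (i : Fin (ℓ + 1)) :
    R.form R.d (R.coroot i) = ((C.mark i : ℂ) / C.comark i) * R.root i R.d := by
  conv_lhs => rw [← R.cartanBasis_some, ← R.cartanBasis_none]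
  rw [form, Module.Basis.constr_basis, Module.Basis.constr_basis]

theorem form_d_d : R.form R.d R.d = 0 := by
  conv_lhs => rw [← R.cartanBasis_none]
  rw [form, Module.Basis.constr_basis, Module.Basis.constr_basis]

theorem form_d_central : R.form R.d R.central = 1 := by
  simp [central, R.form_d_coroot, R.root_d, C.mark_zero, C.comark_zero]

theorem form_injective : Function.Injective R.form := by
  rw [injective_iff_map_eq_zero]
  intro x hx
  set b := R.cartanBasis with hb
  have hsum : x = b.repr x none • R.d + ∑ i, b.repr x (some i) • R.coroot i := by
    conv_lhs => rw [← b.sum_repr x, Fintype.sum_option]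
    simp [hb, R.cartanBasis_some, R.cartanBasis_none]
  have hform : ∀ y, b.repr x none * R.form R.d y
      + ∑ i, b.repr x (some i) * (((C.mark i : ℂ) / C.comark i) * R.root i y) = 0 := by
    intro y
    have h : R.form x y = 0 := by rw [hx]; rfl
    rw [hsum] at h
    simpa [R.form_coroot] using h
  have h0 : b.repr x none = 0 := by
    simpa [R.form_d_central, R.root_central] using hform R.central
  have hlin : ∑ i, (b.repr x (some i) * ((C.mark i : ℂ) / C.comark i)) • R.root i = 0 := by
    ext y
    simpa [h0, mul_assoc] using hform y
  have hi := Fintype.linearIndependent_iff.1 R.linearIndependent_root _ hlin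
  rw [hsum, h0]
  simp only [zero_smul, zero_add]
  refine Finset.sum_eq_zero fun i _ => ?_
  have hm : (C.mark i : ℂ) ≠ 0 := by exact_mod_cast (C.mark_pos i).ne'
  have hc : (C.comark i : ℂ) ≠ 0 := by exact_mod_cast (C.comark_pos i).ne'
  have := hi i
  rw [mul_eq_zero] at this
  rcases this with h | h
  · rw [h, zero_smul]
  · exact absurd h (div_ne_zero hm hc)

/-- The isomorphism `ν : 𝔥 ≃ 𝔥*` induced by `(·|·)`. -/
def nu : 𝔥 ≃ₗ[ℂ] Dual ℂ 𝔥 :=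
  haveI : FiniteDimensional ℂ 𝔥 :=
    FiniteDimensional.of_finrank_pos (by rw [R.finrank_eq]; omega)
  LinearMap.linearEquivOfInjective R.form R.form_injective Subspace.dual_finrank_eq.symm

/-- The bilinear form `(λ|μ) = (ν⁻¹ λ | ν⁻¹ μ)` on `ᴸ𝔥 = 𝔥*`. -/
def dualForm (lam mu : Dual ℂ 𝔥) : ℂ := R.form (R.nu.symm lam) (R.nu.symm mu)

/-- `ρ` is the element of `𝔥*` with `⟨ρ, α̌_i⟩ = 1` for all `i` and `(ρ|ρ) = 0`. -/
structure IsRho (ρ : Dual ℂ 𝔥) : Prop where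
  coroot : ∀ i, ρ (R.coroot i) = 1
  self : R.dualForm ρ ρ = 0

/-! ### The Langlands dual affine Lie algebra, by generators and relations -/

/-- Generators: the elements of `ᴸ𝔥 = 𝔥*`, and the Chevalley generators `ě_i`, `f̌_i`. -/
inductive Gen (ℓ : ℕ) (V : Type*)
  | H : V → Gen ℓ V
  | E : Fin (ℓ + 1) → Gen ℓ V
  | F : Fin (ℓ + 1) → Gen ℓ V

/-- The free Lie algebra on the generators. -/
abbrev Free (_ : Realization C 𝔥) := FreeLieAlgebra ℂ (Gen ℓ (Dual ℂ 𝔥))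

/-- The generator attached to `x ∈ 𝔥*`, in the free Lie algebra. -/
def genH (x : Dual ℂ 𝔥) : R.Free := FreeLieAlgebra.of ℂ (Gen.H x)
/-- The generator `ě_i`, in the free Lie algebra. -/
def genE (i : Fin (ℓ + 1)) : R.Free := FreeLieAlgebra.of ℂ (Gen.E i)
/-- The generator `f̌_i`, in the free Lie algebra. -/
def genF (i : Fin (ℓ + 1)) : R.Free := FreeLieAlgebra.of ℂ (Gen.F i)

/-- The elements set to zero: linearity of `𝔥* → ᴸ𝔤`, the Chevalley relations and the Serre
relations of the Kac–Moody algebra of the transposed matrix `ᵗA`. -/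
inductive IsRelator : R.Free → Prop
  | H_add (x y : Dual ℂ 𝔥) : IsRelator (R.genH (x + y) - (R.genH x + R.genH y))
  | H_smul (t : ℂ) (x : Dual ℂ 𝔥) : IsRelator (R.genH (t • x) - t • R.genH x)
  | H_H (x y : Dual ℂ 𝔥) : IsRelator ⁅R.genH x, R.genH y⁆
  | H_E (x : Dual ℂ 𝔥) (i : Fin (ℓ + 1)) :
      IsRelator (⁅R.genH x, R.genE i⁆ - x (R.coroot i) • R.genE i)
  | H_F (x : Dual ℂ 𝔥) (i : Fin (ℓ + 1)) :
      IsRelator (⁅R.genH x, R.genF i⁆ + x (R.coroot i) • R.genF i)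
  | E_F (i j : Fin (ℓ + 1)) :
      IsRelator (⁅R.genE i, R.genF j⁆ - if i = j then R.genH (R.root i) else 0)
  | serre_E (i j : Fin (ℓ + 1)) (h : i ≠ j) :
      IsRelator (((LieAlgebra.ad ℂ R.Free (R.genE i)) ^ (1 - C.A j i).toNat) (R.genE j))
  | serre_F (i j : Fin (ℓ + 1)) (h : i ≠ j) :
      IsRelator (((LieAlgebra.ad ℂ R.Free (R.genF i)) ^ (1 - C.A j i).toNat) (R.genF j))

/-- The ideal generated by the relations. -/
def relIdeal : LieIdeal ℂ R.Free := LieSubmodule.lieSpan ℂ R.Free {x | R.IsRelator x}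

/-- The affine Kac–Moody algebra `ᴸ𝔤 = 𝔤(ᵗA)`. -/
def LDual := R.Free ⧸ R.relIdeal
deriving LieRing, LieAlgebra ℂ

/-- The quotient map from the free Lie algebra to `ᴸ𝔤`. -/
def toLDual (x : R.Free) : R.LDual := LieSubmodule.Quotient.mk (N := R.relIdeal) x

/-- The canonical map `ᴸ𝔥 = 𝔥* → ᴸ𝔤`. -/
def H (x : Dual ℂ 𝔥) : R.LDual := R.toLDual (R.genH x)
/-- The Chevalley generators `ě_i` of `ᴸ𝔫₊`. -/
def E (i : Fin (ℓ + 1)) : R.LDual := R.toLDual (R.genE i)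
/-- The Chevalley generators `f̌_i` of `ᴸ𝔫₋`. -/
def F (i : Fin (ℓ + 1)) : R.LDual := R.toLDual (R.genF i)

/-- The root space of `ᴸ𝔤` for the element `∑ r_i α̌_i` of the root lattice of `ᴸ𝔤`. -/
def rootSpace (r : Fin (ℓ + 1) → ℤ) : Submodule ℂ R.LDual where
  carrier := {x | ∀ h : Dual ℂ 𝔥, ⁅R.H h, x⁆ = h (∑ i, r i • R.coroot i) • x}
  add_mem' := by
    intro x y hx hy h
    rw [lie_add, hx h, hy h, smul_add]
  zero_mem' := by intro h; simp
  smul_mem' := by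
    intro t x hx h
    rw [lie_smul, hx h, smul_comm]

/-- The piece `ᴸ𝔤_n` of the principal gradation: the sum of the root spaces of height `n`. -/
def graded (n : ℤ) : Submodule ℂ R.LDual :=
  ⨆ (r : Fin (ℓ + 1) → ℤ) (_ : ∑ i, r i = n), R.rootSpace r

/-- The cyclic element `p_{-1} = ∑ f̌_i`. -/
def pNegOne : R.LDual := ∑ i, R.F i

/-- The element `p_1 = ∑ a_i ě_i`. -/
def pOne : R.LDual := ∑ i, (C.mark i : ℂ) • R.E i

/-- For `n ≠ 0`, the piece `𝔞_n` of the principal subalgebra: the elements of `ᴸ𝔤_n` that commute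
with `p_{-1}` modulo the centre `ℂ δ`. -/
def principal (n : ℤ) : Submodule ℂ R.LDual :=
  R.graded n ⊓ (Submodule.span ℂ {R.H R.delta}).comap
    (LieAlgebra.ad ℂ R.LDual R.pNegOne)

end Realization

/-! ### Meromorphic functions on the projective line -/

/-- The field of meromorphic functions on `ℙ¹`, i.e. of rational functions of the coordinate `z`. -/
abbrev Mer := RatFunc ℂ

/-- The derivative of a rational function, given by the quotient rule. -/
def merDerivFun (f : Mer) : Mer :=
  algebraMap (Polynomial ℂ) Mer
      (Polynomial.derivative f.num * f.denom - f.num * Polynomial.derivative f.denom) /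
    algebraMap (Polynomial ℂ) Mer f.denom ^ 2

theorem merDerivFun_div (p q : Polynomial ℂ) (hq : q ≠ 0) :
    merDerivFun (algebraMap (Polynomial ℂ) Mer p / algebraMap (Polynomial ℂ) Mer q) =
      algebraMap (Polynomial ℂ) Mer
        (Polynomial.derivative p * q - p * Polynomial.derivative q) /
        algebraMap (Polynomial ℂ) Mer q ^ 2 := by
  set f : Mer := algebraMap (Polynomial ℂ) Mer p / algebraMap (Polynomial ℂ) Mer q with hf
  have hd : f.denom ≠ 0 := f.denom_ne_zero
  have hq' : algebraMap (Polynomial ℂ) Mer q ≠ 0 := RatFunc.algebraMap_ne_zero hq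
  have hd' : algebraMap (Polynomial ℂ) Mer f.denom ≠ 0 := RatFunc.algebraMap_ne_zero hd
  have key : f.num * q = p * f.denom := by
    apply RatFunc.algebraMap_injective ℂ
    have h := RatFunc.num_div_denom f
    rw [hf] at h
    rw [← hf] at h
    rw [map_mul, map_mul]
    have h2 : algebraMap (Polynomial ℂ) Mer f.num / algebraMap (Polynomial ℂ) Mer f.denom =
        algebraMap (Polynomial ℂ) Mer p / algebraMap (Polynomial ℂ) Mer q := by rw [h]
    rwa [div_eq_div_iff hd' hq'] at h2
  have key' := congrArg Polynomial.derivative key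
  rw [Polynomial.derivative_mul, Polynomial.derivative_mul] at key'
  have key2 : (Polynomial.derivative f.num * f.denom - f.num * Polynomial.derivative f.denom)
      * q ^ 2 = (Polynomial.derivative p * q - p * Polynomial.derivative q) * f.denom ^ 2 := by
    linear_combination (q * f.denom) * key' -
      (q * Polynomial.derivative f.denom + f.denom * Polynomial.derivative q) * key
  rw [merDerivFun, div_eq_div_iff (pow_ne_zero _ hd') (pow_ne_zero _ hq'), ← map_pow, ← map_pow,
    ← map_mul, ← map_mul, key2]

/-- The derivative `∂_z` on the field of meromorphic functions on `ℙ¹`. -/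
def merDeriv : Mer →ₗ[ℂ] Mer where
  toFun := merDerivFun
  map_add' f g := by
    have hf' : algebraMap (Polynomial ℂ) Mer f.denom ≠ 0 :=
      RatFunc.algebraMap_ne_zero f.denom_ne_zero
    have hg' : algebraMap (Polynomial ℂ) Mer g.denom ≠ 0 :=
      RatFunc.algebraMap_ne_zero g.denom_ne_zero
    have h : f + g = algebraMap (Polynomial ℂ) Mer (f.num * g.denom + f.denom * g.num) /
        algebraMap (Polynomial ℂ) Mer (f.denom * g.denom) := by
      conv_lhs => rw [← RatFunc.num_div_denom f, ← RatFunc.num_div_denom g]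
      rw [div_add_div _ _ hf' hg']
      simp only [map_add, map_mul]
    rw [h, merDerivFun_div _ _ (mul_ne_zero f.denom_ne_zero g.denom_ne_zero), merDerivFun,
      merDerivFun, div_add_div _ _ (pow_ne_zero _ hf') (pow_ne_zero _ hg'),
      div_eq_div_iff (pow_ne_zero _ (RatFunc.algebraMap_ne_zero
        (mul_ne_zero f.denom_ne_zero g.denom_ne_zero)))
        (mul_ne_zero (pow_ne_zero _ hf') (pow_ne_zero _ hg'))]
    simp only [← map_pow, ← map_mul, ← map_add]
    refine congrArg (algebraMap (Polynomial ℂ) Mer) ?_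
    simp only [Polynomial.derivative_mul, Polynomial.derivative_add]
    ring
  map_smul' t f := by
    have h : t • f = algebraMap (Polynomial ℂ) Mer (Polynomial.C t * f.num) /
        algebraMap (Polynomial ℂ) Mer f.denom := by
      conv_lhs => rw [← RatFunc.num_div_denom f]
      rw [map_mul, mul_div_assoc, RatFunc.algebraMap_C, RatFunc.smul_eq_C_mul]
    rw [h, merDerivFun_div _ _ f.denom_ne_zero, merDerivFun]
    simp only [RingHom.id_apply, RatFunc.smul_eq_C_mul, ← RatFunc.algebraMap_C]
    rw [← mul_div_assoc, ← map_mul]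
    congr 2
    simp only [Polynomial.derivative_mul, Polynomial.derivative_C]
    ring

/-- `f` is a continuous branch of the logarithm on a neighbourhood of `x`. -/
def IsLogBranchNear (f : ℂ → ℂ) (x : ℂ) : Prop :=
  ∀ᶠ y in 𝓝 x, ContinuousAt f y ∧ Complex.exp (f y) = y

/-- The rational function `1 / (z - x)`. -/
def simplePole (x : ℂ) : Mer := (RatFunc.X - RatFunc.C x)⁻¹

namespace Realization

variable {ℓ : ℕ} {C : AffineCartanMatrix ℓ} {𝔥 : Type*} [AddCommGroup 𝔥] [Module ℂ 𝔥]
  (R : Realization C 𝔥)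

/-! ### Connections and gauge transformations, grade by grade -/

/-- Formal families `u = ∑ u_n` with `u_n ∈ ᴸ𝔤(ℳ) = ℳ ⊗ ᴸ𝔤`. The completion `ᴸ𝔤^(ℳ)` consists of
those with `u_n ∈ ᴸ𝔤_n(ℳ)` for all `n` and `u_n = 0` for `n` sufficiently negative. -/
abbrev Series := ℤ → Mer ⊗[ℂ] R.LDual

/-- The completed Borel subalgebra `ᴸ𝔟^₊(ℳ)`: series `∑_{n ≥ 0} b_n` with `b_n ∈ ᴸ𝔤_n(ℳ)`. -/
def borelHat : Set R.Series :=
  {b | (∀ n, b n ∈ (R.graded n).baseChange Mer) ∧ ∀ n < 0, b n = 0}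

/-- The completed nilpotent subalgebra `ᴸ𝔫^₊(ℳ)`: series `∑_{n > 0} m_n` with `m_n ∈ ᴸ𝔤_n(ℳ)`. -/
def nilHat : Set R.Series :=
  {m | (∀ n, m n ∈ (R.graded n).baseChange Mer) ∧ ∀ n ≤ 0, m n = 0}

/-- The completion `𝔞^_{≥ 1}(ℳ)` of the positive part of the principal subalgebra. -/
def principalHat : Set R.Series :=
  {a | (∀ n, 1 ≤ n → a n ∈ (R.principal n).baseChange Mer) ∧ ∀ n ≤ 0, a n = 0}

/-- `p_{-1}` as a series. -/
def pNegOneSeries : R.Series := Pi.single (-1) (1 ⊗ₜ[ℂ] R.pNegOne)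

/-- The space of `ᴸ𝔤`-connections `d + A dz` with `A = p_{-1} + b`, `b ∈ ᴸ𝔟^₊(ℳ)`; such a
connection is identified with the series `A`. -/
def connections : Set R.Series := {A | ∃ b ∈ R.borelHat, A = R.pNegOneSeries + b}

/-- The Lie bracket of series: `[x, y]_k = ∑_n [x_n, y_{k-n}]`. The sum is finite when `x` and `y`
vanish in sufficiently negative degrees. -/
def seriesBracket (x y : R.Series) : R.Series := fun k => ∑ᶠ n : ℤ, ⁅x n, y (k - n)⁆

/-- The derivative `∂_z` of a series, coefficient by coefficient. -/
def seriesDeriv (x : R.Series) : R.Series := fun n => merDeriv.rTensor R.LDual (x n)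

/-- `g u g⁻¹ = ∑_{k ≥ 0} (1/k!) ad_m^k u` for `g = exp m`; a finite sum in each degree when
`m ∈ ᴸ𝔫^₊(ℳ)`. -/
def expAd (m u : R.Series) : R.Series := fun n =>
  ∑ᶠ k : ℕ, ((k.factorial : ℂ)⁻¹) • ((R.seriesBracket m)^[k] u) n

/-- `(∂_z g) g⁻¹ = ∑_{k ≥ 1} (1/k!) ad_m^{k-1} ∂_z m` for `g = exp m`. -/
def expLogDeriv (m : R.Series) : R.Series := fun n =>
  ∑ᶠ k : ℕ, (((k + 1).factorial : ℂ)⁻¹) • ((R.seriesBracket m)^[k] (R.seriesDeriv m)) n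

/-- The gauge transformation of `d + A dz` by `g = exp m`: `d + (g A g⁻¹ - (∂_z g) g⁻¹) dz`. -/
def gauge (m A : R.Series) : R.Series := R.expAd m A - R.expLogDeriv m

/-- The `ᴸ𝔤`-oper `[∇]` underlying `∇ = d + A dz`: the orbit of `∇` under gauge transformations by
the group `exp ᴸ𝔫^₊(ℳ)`. -/
def oper (A : R.Series) : Set R.Series := {A' | ∃ m ∈ R.nilHat, A' = R.gauge m A}

/-- `d + A dz` is in quasi-canonical form, with twist function `φ`:
`A = p_{-1} - (φ / h^∨) ρ + a` with `a ∈ 𝔞^_{≥ 1}(ℳ)`. -/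
def IsQuasiCanonical (ρ : Dual ℂ 𝔥) (φ : Mer) (A : R.Series) : Prop :=
  ∃ a ∈ R.principalHat, A = R.pNegOneSeries
    - (Pi.single 0 ((φ / (C.dualCoxeter : Mer)) ⊗ₜ[ℂ] R.H ρ) : R.Series) + a

/-- The Miura oper `d + p_{-1} dz - ∑_i λ_i / (z - z_i) dz + ∑_j α_{c(j)} / (z - w_j) dz`. -/
def miura {N m : ℕ} (z : Fin N → ℂ) (lam : Fin N → Dual ℂ 𝔥) (w : Fin m → ℂ)
    (c : Fin m → Fin (ℓ + 1)) : R.Series :=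
  R.pNegOneSeries + (Pi.single 0
    (-(∑ i, simplePole (z i) ⊗ₜ[ℂ] R.H (lam i)) +
      ∑ j, simplePole (w j) ⊗ₜ[ℂ] R.H (R.root (c j))) : R.Series)

/-! ### The master function -/

/-- `Φ` is, near the point `(z, w)`, a branch of the multivalued master function
`∑_{i<j} (λ_i|λ_j) log (z_i - z_j) - ∑_{i,j} (λ_i|α_{c(j)}) log (z_i - w_j)
  + ∑_{i<j} (α_{c(i)}|α_{c(j)}) log (w_i - w_j)`. -/
def IsMasterFunctionNear {N m : ℕ} (z : Fin N → ℂ) (lam : Fin N → Dual ℂ 𝔥) (w : Fin m → ℂ)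
    (c : Fin m → Fin (ℓ + 1)) (Φ : (Fin N → ℂ) → (Fin m → ℂ) → ℂ) : Prop :=
  ∃ (logZZ : Fin N → Fin N → ℂ → ℂ) (logZW : Fin N → Fin m → ℂ → ℂ)
    (logWW : Fin m → Fin m → ℂ → ℂ),
    (∀ i j, i < j → IsLogBranchNear (logZZ i j) (z i - z j)) ∧
    (∀ i j, IsLogBranchNear (logZW i j) (z i - w j)) ∧
    (∀ i j, i < j → IsLogBranchNear (logWW i j) (w i - w j)) ∧
    ∀ᶠ q : (Fin N → ℂ) × (Fin m → ℂ) in 𝓝 (z, w), Φ q.1 q.2 =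
      (∑ i, ∑ j ∈ Finset.Ioi i, R.dualForm (lam i) (lam j) * logZZ i j (q.1 i - q.1 j))
      - (∑ i, ∑ j, R.dualForm (lam i) (R.root (c j)) * logZW i j (q.1 i - q.2 j))
      + ∑ i, ∑ j ∈ Finset.Ioi i,
          R.dualForm (R.root (c i)) (R.root (c j)) * logWW i j (q.2 i - q.2 j)

end Realization

end AffineOper

end

open AffineOper

/-! Write the connection as d + p_{-1} dz + U dz with U valued in 𝔥*, and let exp(m) bring it to
quasi-canonical form. In degrees 0 and 1 only m_1 = ∑ x_i ě_i and m_2 intervene. With Y = ∑ x_i α_i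
= [m_1, p_{-1}] and q = φ/h^∨, degree 0 reads U + Y = -qρ, and degree 1 reads v_1 p_1 = [m_1, U] +
[m_2, p_{-1}] + ½ [m_1, Y] - m_1'. Pairing with p_{-1} under the invariant form means applying a
functional with ě_i ↦ ǎ_i/a_i. It sends p_1 to h^∨, kills [m_2, p_{-1}], and turns [m_1, X] into
-(Y|X) for X in 𝔥* and m_1' into (Y'|ρ). Substituting Y = -U - qρ, every term in q cancels because
(ρ|ρ) = 0, and h^∨ v_1 = ½ (U|U) + (U'|ρ) remains, whatever the quasi-canonical form
(`exists_coefficient_pOne`).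

For U = ∑ μ_a/(z - p_a), partial fractions give double poles ½ (μ_a|μ_a) - (μ_a|ρ) and residues
∑_{b≠a} (μ_a|μ_b)/(p_a - p_b). The former is ½ (λ|λ+2ρ) for μ = -λ and 0 for a simple root; the
latter are the partial derivatives of Φ.

Since ᴸ𝔤 is given by generators and relations, three facts have to be proved about it: 𝔥* embeds in
it (`H_injective`, through Verma modules); degrees 1 and 2 are spanned by the ě_i and the [ě_i, ě_j]
(triangular decomposition); and A is symmetrised by the ratios ǎ_i/a_i (`skewPart_eq_zero`, a
counting argument on the Dynkin diagram). The last fact makes the form symmetric and the functional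
vanish on [ᴸ𝔤_2, p_{-1}]. -/

noncomputable section

namespace AffineOper

/-! ### Chevalley relations, Serre elements and the spaces they generate -/

section

variable {ι L : Type*} [LieRing L] [LieAlgebra ℂ L]

/-- The iterated brackets of the `f i` with elements of a set `s`. -/
inductive IteratedBracket (f : ι → L) (s : Set L) : L → Prop
  | base (y : L) : y ∈ s → IteratedBracket f s y
  | step (i : ι) (y : L) : IteratedBracket f s y → IteratedBracket f s ⁅f i, y⁆

theorem span_iteratedBracket_lie_f (f : ι → L) (s : Set L) (i : ι) {y : L}
    (hy : y ∈ Submodule.span ℂ {y | IteratedBracket f s y}) :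
    ⁅f i, y⁆ ∈ Submodule.span ℂ {y | IteratedBracket f s y} := by
  induction hy using Submodule.span_induction with
  | mem y hy => exact Submodule.subset_span (IteratedBracket.step i y hy)
  | zero => simp
  | add x y _ _ hx hy => rw [lie_add]; exact add_mem hx hy
  | smul t x _ hx => rw [lie_smul]; exact Submodule.smul_mem _ _ hx

end

/-- Elements `h x`, `e i`, `f i` of a Lie algebra that satisfy the Chevalley relations. -/
structure ChevalleyRelations {ι V L : Type*} [DecidableEq ι] [AddCommGroup V] [Module ℂ V]
    [LieRing L] [LieAlgebra ℂ L] (wt : ι → V → ℂ) (root : ι → V) (h : V → L) (e f : ι → L) :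
    Prop where
  h_h : ∀ x y, ⁅h x, h y⁆ = 0
  h_e : ∀ x i, ⁅h x, e i⁆ = wt i x • e i
  h_f : ∀ x i, ⁅h x, f i⁆ = -(wt i x • f i)
  e_f : ∀ i j, ⁅e i, f j⁆ = if i = j then h (root i) else 0

namespace ChevalleyRelations

variable {ι V L : Type*} [DecidableEq ι] [AddCommGroup V] [Module ℂ V]
    [LieRing L] [LieAlgebra ℂ L] {wt : ι → V → ℂ} {root : ι → V} {h : V → L} {e f : ι → L}

/-- The Chevalley involution. -/
theorem swap (D : ChevalleyRelations wt root h e f) :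
    ChevalleyRelations wt root (fun x => -h x) f e where
  h_h x y := by simp [D.h_h]
  h_e x i := by simp [D.h_f]
  h_f x i := by simp [D.h_e]
  e_f i j := by
    rw [← lie_skew, D.e_f]
    by_cases hij : i = j
    · simp [hij]
    · simp [hij, Ne.symm hij]

theorem lie_h_ad_pow (D : ChevalleyRelations wt root h e f) (x : V) (i j : ι) (n : ℕ) :
    ⁅h x, ((LieAlgebra.ad ℂ L (f i)) ^ n) (f j)⁆
      = (-(wt j x) - n * wt i x) • ((LieAlgebra.ad ℂ L (f i)) ^ n) (f j) := by
  induction n with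
  | zero => simp [D.h_f]
  | succ n ih =>
    rw [pow_succ', Module.End.mul_apply, LieAlgebra.ad_apply, leibniz_lie, D.h_f, ih]
    simp only [neg_lie, smul_lie, lie_smul]
    push_cast
    module

theorem lie_e_ad_pow_succ (D : ChevalleyRelations wt root h e f) {i j : ι} (hij : i ≠ j)
    (h2 : wt i (root i) = 2) (n : ℕ) :
    ⁅e i, ((LieAlgebra.ad ℂ L (f i)) ^ (n + 1)) (f j)⁆
      = ((n + 1) * (-(wt j (root i)) - n)) • ((LieAlgebra.ad ℂ L (f i)) ^ n) (f j) := by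
  induction n with
  | zero =>
    rw [zero_add, pow_one, LieAlgebra.ad_apply, leibniz_lie, D.e_f, D.e_f]
    simp [hij, D.h_f]
  | succ n ih =>
    rw [pow_succ', Module.End.mul_apply, LieAlgebra.ad_apply, leibniz_lie, ih, D.e_f, if_pos rfl,
      D.lie_h_ad_pow, h2, lie_smul, ← LieAlgebra.ad_apply ℂ L (f i), ← Module.End.mul_apply,
      ← pow_succ', ← add_smul]
    congr 1
    push_cast
    ring

/-- The Serre elements of one half commute with the generators of the other half. -/
theorem lie_e_serre (D : ChevalleyRelations wt root h e f) {i j : ι} (hij : i ≠ j)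
    (h2 : wt i (root i) = 2) {n : ℕ} (hn : wt j (root i) = -n)
    (h0 : n = 0 → wt i (root j) = 0) (k : ι) :
    ⁅e k, ((LieAlgebra.ad ℂ L (f i)) ^ (n + 1)) (f j)⁆ = 0 := by
  by_cases hki : k = i
  · subst hki
    rw [D.lie_e_ad_pow_succ hij h2, hn]
    simp
  -- For k ≠ i, `e k` commutes with `f i`, so it passes through to the innermost `f j`.
  · have hcomm : ∀ (m : ℕ) (y : L), ⁅e k, ((LieAlgebra.ad ℂ L (f i)) ^ m) y⁆
        = ((LieAlgebra.ad ℂ L (f i)) ^ m) ⁅e k, y⁆ := by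
      intro m y
      induction m with
      | zero => simp
      | succ m ih =>
        rw [pow_succ', Module.End.mul_apply, Module.End.mul_apply, LieAlgebra.ad_apply,
          leibniz_lie, D.e_f, if_neg hki, ih, zero_lie, zero_add, LieAlgebra.ad_apply]
    rw [hcomm, D.e_f]
    by_cases hkj : k = j
    -- What remains is wt_i(α_j) (ad f_i)^n f_i. It vanishes for n ≥ 1 since [f_i, f_i] = 0, and for
    -- n = 0 by `h0`.
    · subst hkj
      rw [if_pos rfl, pow_succ, Module.End.mul_apply, LieAlgebra.ad_apply, ← lie_skew, D.h_f,
        neg_neg, map_smul]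
      rcases n with _ | n
      · rw [h0 rfl, zero_smul]
      · rw [pow_succ, Module.End.mul_apply, LieAlgebra.ad_apply, lie_self, map_zero, smul_zero]
    · rw [if_neg hkj, map_zero]

theorem iteratedBracket_lie_h (D : ChevalleyRelations wt root h e f) {s : Set L}
    (hs : ∀ y ∈ s, ∀ x, ∃ t : ℂ, ⁅h x, y⁆ = t • y) (x : V) {y : L}
    (hy : IteratedBracket f s y) : ∃ t : ℂ, ⁅h x, y⁆ = t • y := by
  induction hy with
  | base y hy => exact hs y hy x
  | step i y _ ih =>
    obtain ⟨t, ht⟩ := ih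
    refine ⟨t - wt i x, ?_⟩
    rw [leibniz_lie, D.h_f, ht, neg_lie, smul_lie, lie_smul]
    module

theorem span_iteratedBracket_lie_h (D : ChevalleyRelations wt root h e f) {s : Set L}
    (hs : ∀ y ∈ s, ∀ x, ∃ t : ℂ, ⁅h x, y⁆ = t • y) (x : V) {y : L}
    (hy : y ∈ Submodule.span ℂ {y | IteratedBracket f s y}) :
    ⁅h x, y⁆ ∈ Submodule.span ℂ {y | IteratedBracket f s y} := by
  induction hy using Submodule.span_induction with
  | mem y hy =>
    obtain ⟨t, ht⟩ := D.iteratedBracket_lie_h hs x hy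
    rw [ht]
    exact Submodule.smul_mem _ _ (Submodule.subset_span hy)
  | zero => simp
  | add x y _ _ hx hy => rw [lie_add]; exact add_mem hx hy
  | smul t x _ hx => rw [lie_smul]; exact Submodule.smul_mem _ _ hx

/-- A raising generator kills `s` and meets each `f i` in a Cartan element or in zero, and Cartan
elements scale iterated brackets. Hence brackets with the `f i` alone already give a space stable
under all the generators. -/
theorem span_iteratedBracket_lie_e (D : ChevalleyRelations wt root h e f) {s : Set L}
    (hs : ∀ y ∈ s, ∀ x, ∃ t : ℂ, ⁅h x, y⁆ = t • y) (hs' : ∀ y ∈ s, ∀ k, ⁅e k, y⁆ = 0) (k : ι)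
    {y : L} (hy : y ∈ Submodule.span ℂ {y | IteratedBracket f s y}) :
    ⁅e k, y⁆ ∈ Submodule.span ℂ {y | IteratedBracket f s y} := by
  induction hy using Submodule.span_induction with
  | mem y hy =>
    induction hy with
    | base y hy => rw [hs' y hy]; exact zero_mem _
    | step i y hy ih =>
      rw [leibniz_lie, D.e_f]
      refine add_mem ?_ (span_iteratedBracket_lie_f f s i ih)
      split_ifs
      · exact D.span_iteratedBracket_lie_h hs _ (Submodule.subset_span hy)
      · simp
  | zero => simp
  | add x y _ _ hx hy => rw [lie_add]; exact add_mem hx hy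
  | smul t x _ hx => rw [lie_smul]; exact Submodule.smul_mem _ _ hx

end ChevalleyRelations

/-- The elements whose adjoint action preserves a given subspace. -/
def stabilizer {L : Type*} [LieRing L] [LieAlgebra ℂ L] (J : Submodule ℂ L) :
    LieSubalgebra ℂ L where
  carrier := {a | ∀ y ∈ J, ⁅a, y⁆ ∈ J}
  add_mem' ha hb y hy := by rw [add_lie]; exact add_mem (ha y hy) (hb y hy)
  zero_mem' y hy := by simp
  smul_mem' t a ha y hy := by rw [smul_lie]; exact J.smul_mem t (ha y hy)
  lie_mem' {a b} ha hb y hy := by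
    rw [lie_lie]
    exact sub_mem (ha _ (hb y hy)) (hb _ (ha y hy))

theorem freeLieAlgebra_subalgebra_eq_top {X : Type*} (S : LieSubalgebra ℂ (FreeLieAlgebra ℂ X))
    (hS : ∀ x, FreeLieAlgebra.of ℂ x ∈ S) (a : FreeLieAlgebra ℂ X) : a ∈ S := by
  have h : S.incl.comp (FreeLieAlgebra.lift ℂ fun x => (⟨FreeLieAlgebra.of ℂ x, hS x⟩ : S))
      = LieHom.id := by
    apply FreeLieAlgebra.hom_ext
    intro x
    simp
  have h2 := LieHom.congr_fun h a
  simp only [LieHom.comp_apply, LieHom.id_apply] at h2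
  rw [← h2]
  exact Subtype.property _

/-! ### Operators on the free associative algebra -/

namespace FreeVerma

attribute [local instance] LieRing.ofAssociativeRing

variable {ι V : Type*} [AddCommGroup V] [Module ℂ V]

/-- The operator of left multiplication by the generator `i`. -/
def lower (i : ι) : Module.End ℂ (FreeAlgebra ℂ ι) := LinearMap.mulLeft ℂ (FreeAlgebra.ι ℂ i)

theorem lower_apply (i : ι) (a : FreeAlgebra ℂ ι) : lower i a = FreeAlgebra.ι ℂ i * a := rfl

theorem apply_eq_of_commute (G : Module.End ℂ (FreeAlgebra ℂ ι)) (hG : ∀ i : ι, ⁅G, lower i⁆ = 0)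
    (a b : FreeAlgebra ℂ ι) : G (a * b) = a * G b := by
  induction a using FreeAlgebra.induction generalizing b with
  | grade0 r => rw [← Algebra.smul_def, ← Algebra.smul_def, map_smul]
  | grade1 i =>
    have := LinearMap.congr_fun (hG i) b
    rw [Ring.lie_def, LinearMap.sub_apply, LinearMap.zero_apply, sub_eq_zero] at this
    exact this
  | mul a a' ha ha' => rw [mul_assoc, ha, ha', mul_assoc]
  | add a a' ha ha' => rw [add_mul, map_add, ha, ha', add_mul]

/-- Such a `G` is right multiplication by `G 1`. Relations between operators can thus be checked on
the vacuum vector 1 and on commutators with the lowering operators. -/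
theorem eq_zero_of_commute (G : Module.End ℂ (FreeAlgebra ℂ ι)) (hG : ∀ i : ι, ⁅G, lower i⁆ = 0)
    (h1 : G 1 = 0) : G = 0 := by
  ext a
  have := apply_eq_of_commute G hG a 1
  rw [mul_one, h1, mul_zero] at this
  simpa using this

/-- The homomorphism to triangular operators whose off-diagonal entry at the generator `j`
is `Y j`. -/
def triangular (Y : ι → Module.End ℂ (FreeAlgebra ℂ ι)) :
    FreeAlgebra ℂ ι →ₐ[ℂ] Module.End ℂ (FreeAlgebra ℂ ι × FreeAlgebra ℂ ι) :=
  FreeAlgebra.lift ℂ fun j =>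
    ((lower j ∘ₗ LinearMap.fst ℂ _ _ + Y j ∘ₗ LinearMap.snd ℂ _ _).prod
      (lower j ∘ₗ LinearMap.snd ℂ _ _))

theorem triangular_snd (Y : ι → Module.End ℂ (FreeAlgebra ℂ ι)) (a : FreeAlgebra ℂ ι)
    (p : FreeAlgebra ℂ ι × FreeAlgebra ℂ ι) : (triangular Y a p).2 = a * p.2 := by
  induction a using FreeAlgebra.induction generalizing p with
  | grade0 r =>
    rw [AlgHom.commutes, Module.algebraMap_end_apply, Prod.smul_snd, Algebra.smul_def]
  | grade1 i => simp [triangular, lower_apply]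
  | mul a a' ha ha' => rw [map_mul, Module.End.mul_apply, ha, ha', mul_assoc]
  | add a a' ha ha' => rw [map_add, LinearMap.add_apply, Prod.snd_add, ha, ha', add_mul]

/-- The operator `X` with `X 1 = c` and `[X, lower j] = Y j`. -/
def extend (c : ℂ) (Y : ι → Module.End ℂ (FreeAlgebra ℂ ι)) : Module.End ℂ (FreeAlgebra ℂ ι) :=
  LinearMap.fst ℂ _ _ ∘ₗ (LinearMap.applyₗ ((algebraMap ℂ _ c, 1) :
    FreeAlgebra ℂ ι × FreeAlgebra ℂ ι)) ∘ₗ (triangular Y).toLinearMap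

theorem extend_one (c : ℂ) (Y : ι → Module.End ℂ (FreeAlgebra ℂ ι)) :
    extend c Y 1 = algebraMap ℂ _ c := by
  simp [extend]

/-- Multiplicativity of upper triangular matrices is the Leibniz rule for their corner entry. On the
product of the generator `j` with `b`, the diagonal contributes `lower j` applied to `extend c Y b`,
and the corner contributes `Y j b`. -/
theorem lie_extend_lower (c : ℂ) (Y : ι → Module.End ℂ (FreeAlgebra ℂ ι)) (j : ι) :
    ⁅extend c Y, lower j⁆ = Y j := by
  refine LinearMap.ext fun b => ?_
  rw [Ring.lie_def, LinearMap.sub_apply, sub_eq_iff_eq_add, Module.End.mul_apply, lower_apply,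
    Module.End.mul_apply]
  have h := triangular_snd Y b (algebraMap ℂ _ c, 1)
  simp only [extend, LinearMap.comp_apply, AlgHom.toLinearMap_apply, map_mul,
    LinearMap.applyₗ_apply_apply, Module.End.mul_apply, LinearMap.fst_apply]
  conv_lhs => rw [triangular, FreeAlgebra.lift_ι_apply, ← triangular]
  simp only [LinearMap.prod_apply, Function.prod, LinearMap.add_apply, LinearMap.comp_apply,
    LinearMap.fst_apply, LinearMap.snd_apply, h, mul_one]
  rw [add_comm]

variable (wt : ι → V →ₗ[ℂ] ℂ) (lam : V →ₗ[ℂ] ℂ)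

/-- The action of the Cartan subalgebra, with highest weight `lam`. -/
def cartan (x : V) : Module.End ℂ (FreeAlgebra ℂ ι) :=
  extend (lam x) fun j => -(wt j x • lower j)

theorem cartan_one (x : V) : cartan wt lam x 1 = algebraMap ℂ _ (lam x) := extend_one _ _

theorem lie_cartan_lower (x : V) (j : ι) :
    ⁅cartan wt lam x, lower j⁆ = -(wt j x • lower j) := lie_extend_lower _ _ _

theorem cartan_add (x y : V) : cartan wt lam (x + y) = cartan wt lam x + cartan wt lam y := by
  rw [← sub_eq_zero]
  apply eq_zero_of_commute
  · intro j
    rw [sub_lie, add_lie, lie_cartan_lower, lie_cartan_lower, lie_cartan_lower, map_add]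
    module
  · simp [cartan_one]

theorem cartan_smul (t : ℂ) (x : V) : cartan wt lam (t • x) = t • cartan wt lam x := by
  rw [← sub_eq_zero]
  apply eq_zero_of_commute
  · intro j
    rw [sub_lie, smul_lie, lie_cartan_lower, lie_cartan_lower, map_smul, smul_eq_mul]
    module
  · simp [cartan_one, Algebra.smul_def]

theorem lie_cartan_cartan (x y : V) : ⁅cartan wt lam x, cartan wt lam y⁆ = 0 := by
  apply eq_zero_of_commute
  · intro j
    rw [lie_lie, lie_cartan_lower, lie_cartan_lower, lie_neg, lie_neg, lie_smul, lie_smul,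
      lie_cartan_lower, lie_cartan_lower]
    module
  · rw [Ring.lie_def, LinearMap.sub_apply, Module.End.mul_apply, Module.End.mul_apply, cartan_one,
      cartan_one]
    simp only [Algebra.algebraMap_eq_smul_one, map_smul, cartan_one]
    module

/-- Left multiplication by a generator lands in the augmentation ideal, so bracketing with it keeps
the image of an operator there. This will separate the Serre elements from the Cartan elements,
which act on 1 by the highest weight. -/
theorem algebraMapInv_iteratedBracket {s : Set (Module.End ℂ (FreeAlgebra ℂ ι))}
    (hs : ∀ y ∈ s, ∀ a, FreeAlgebra.algebraMapInv (y a) = 0) {y}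
    (hy : y ∈ Submodule.span ℂ {y | IteratedBracket lower s y})
    (a : FreeAlgebra ℂ ι) : FreeAlgebra.algebraMapInv (y a) = 0 := by
  induction hy using Submodule.span_induction with
  | mem y hy =>
    induction hy generalizing a with
    | base y hy => exact hs y hy a
    | step i y hy ih =>
      rw [Ring.lie_def, LinearMap.sub_apply, Module.End.mul_apply, Module.End.mul_apply, map_sub,
        ih, lower_apply, map_mul]
      simp [FreeAlgebra.algebraMapInv]
  | zero => simp
  | add x y _ _ hx hy => rw [LinearMap.add_apply, map_add, hx, hy, add_zero]
  | smul t x _ hx => rw [LinearMap.smul_apply, map_smul, hx, smul_zero]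

theorem algebraMapInv_ad_pow_lower (i j : ι) (n : ℕ) (a : FreeAlgebra ℂ ι) :
    FreeAlgebra.algebraMapInv
      ((((LieAlgebra.ad ℂ (Module.End ℂ (FreeAlgebra ℂ ι)) (lower i)) ^ n) (lower j)) a)
      = (0 : ℂ) := by
  induction n generalizing a with
  | zero => simp [FreeAlgebra.algebraMapInv, lower_apply]
  | succ n ih =>
    rw [pow_succ', Module.End.mul_apply, LieAlgebra.ad_apply, Ring.lie_def, LinearMap.sub_apply,
      Module.End.mul_apply, Module.End.mul_apply, map_sub, ih, lower_apply, map_mul]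
    simp [FreeAlgebra.algebraMapInv]

variable [DecidableEq ι] (root : ι → V)

/-- The action of the raising operators. -/
def raise (k : ι) : Module.End ℂ (FreeAlgebra ℂ ι) :=
  extend 0 fun j => if k = j then cartan wt lam (root k) else 0

theorem raise_one (k : ι) : raise wt lam root k 1 = 0 := by
  rw [raise, extend_one, map_zero]

theorem lie_raise_lower (k j : ι) :
    ⁅raise wt lam root k, lower j⁆ = if k = j then cartan wt lam (root k) else 0 :=
  lie_extend_lower _ _ _

theorem lie_cartan_raise (x : V) (k : ι) :
    ⁅cartan wt lam x, raise wt lam root k⁆ = wt k x • raise wt lam root k := by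
  rw [← sub_eq_zero]
  apply eq_zero_of_commute
  · intro j
    rw [sub_lie, lie_lie, smul_lie, lie_cartan_lower, lie_neg, lie_smul, lie_raise_lower]
    split_ifs with hkj
    · rw [lie_cartan_cartan, hkj]
      module
    · simp
  · rw [Ring.lie_def, LinearMap.sub_apply, LinearMap.sub_apply, Module.End.mul_apply,
      Module.End.mul_apply, LinearMap.smul_apply, raise_one, cartan_one,
      Algebra.algebraMap_eq_smul_one, map_smul, raise_one]
    simp

theorem chevalleyRelations : ChevalleyRelations (fun i x => wt i x) root (cartan wt lam)
    (raise wt lam root) lower where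
  h_h := lie_cartan_cartan wt lam
  h_e := lie_cartan_raise wt lam root
  h_f := lie_cartan_lower wt lam
  e_f := lie_raise_lower wt lam root

theorem ad_pow_raise_one (i j : ι) (n : ℕ) :
    (((LieAlgebra.ad ℂ (Module.End ℂ (FreeAlgebra ℂ ι)) (raise wt lam root i)) ^ n)
      (raise wt lam root j)) 1 = 0 := by
  induction n with
  | zero => simp [raise_one]
  | succ n ih =>
    rw [pow_succ', Module.End.mul_apply, LieAlgebra.ad_apply, Ring.lie_def, LinearMap.sub_apply,
      Module.End.mul_apply, Module.End.mul_apply, ih, raise_one]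
    simp

end FreeVerma

namespace Realization

variable {ℓ : ℕ} {C : AffineCartanMatrix ℓ} {𝔥 : Type*} [AddCommGroup 𝔥] [Module ℂ 𝔥]
  (R : Realization C 𝔥)

/-! ### The Chevalley relations in the dual algebra, and the embedding of the Cartan subalgebra -/

/-- The quotient map from the free Lie algebra to `ᴸ𝔤`, as a homomorphism. -/
def toLDualHom : R.Free →ₗ⁅ℂ⁆ R.LDual where
  toFun := R.toLDual
  map_add' _ _ := rfl
  map_smul' _ _ := rfl
  map_lie' := rfl

theorem toLDualHom_surjective : Function.Surjective R.toLDualHom :=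
  LieSubmodule.Quotient.surjective_mk' R.relIdeal

theorem toLDualHom_eq_zero_iff (x : R.Free) : R.toLDualHom x = 0 ↔ x ∈ R.relIdeal :=
  LieSubmodule.Quotient.mk_eq_zero R.relIdeal

theorem toLDualHom_relator {x : R.Free} (hx : R.IsRelator x) : R.toLDualHom x = 0 :=
  (R.toLDualHom_eq_zero_iff x).2 (LieSubmodule.subset_lieSpan hx)

theorem H_add (x y : Dual ℂ 𝔥) : R.H (x + y) = R.H x + R.H y := by
  have h := R.toLDualHom_relator (IsRelator.H_add x y)
  rw [map_sub, map_add, sub_eq_zero] at h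
  exact h

theorem H_smul (t : ℂ) (x : Dual ℂ 𝔥) : R.H (t • x) = t • R.H x := by
  have h := R.toLDualHom_relator (IsRelator.H_smul t x)
  rw [map_sub, map_smul, sub_eq_zero] at h
  exact h

/-- The canonical map `ᴸ𝔥 = 𝔥* → ᴸ𝔤` as a linear map. -/
def cartanMap : Dual ℂ 𝔥 →ₗ[ℂ] R.LDual where
  toFun := R.H
  map_add' := R.H_add
  map_smul' := R.H_smul

theorem cartanMap_apply (x : Dual ℂ 𝔥) : R.cartanMap x = R.H x := rfl

theorem lie_H_H (x y : Dual ℂ 𝔥) : ⁅R.H x, R.H y⁆ = 0 := by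
  have h := R.toLDualHom_relator (IsRelator.H_H x y)
  rw [LieHom.map_lie] at h
  exact h

theorem lie_H_E (x : Dual ℂ 𝔥) (i : Fin (ℓ + 1)) : ⁅R.H x, R.E i⁆ = x (R.coroot i) • R.E i := by
  have h := R.toLDualHom_relator (IsRelator.H_E x i)
  rw [map_sub, map_smul, LieHom.map_lie, sub_eq_zero] at h
  exact h

theorem lie_H_F (x : Dual ℂ 𝔥) (i : Fin (ℓ + 1)) :
    ⁅R.H x, R.F i⁆ = -(x (R.coroot i) • R.F i) := by
  have h := R.toLDualHom_relator (IsRelator.H_F x i)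
  rw [map_add, map_smul, LieHom.map_lie, add_eq_zero_iff_eq_neg] at h
  exact h

theorem lie_E_F (i j : Fin (ℓ + 1)) :
    ⁅R.E i, R.F j⁆ = if i = j then R.H (R.root i) else 0 := by
  have h := R.toLDualHom_relator (IsRelator.E_F i j)
  rw [map_sub, LieHom.map_lie, sub_eq_zero] at h
  refine h.trans ?_
  split_ifs
  · rfl
  · exact map_zero _

theorem chevalleyRelations : ChevalleyRelations (fun i x => x (R.coroot i)) R.root R.H R.E R.F where
  h_h := R.lie_H_H
  h_e := R.lie_H_E
  h_f := R.lie_H_F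
  e_f := R.lie_E_F

theorem subalgebra_eq_top (S : LieSubalgebra ℂ R.LDual) (hH : ∀ x, R.H x ∈ S)
    (hE : ∀ i, R.E i ∈ S) (hF : ∀ i, R.F i ∈ S) (a : R.LDual) : a ∈ S := by
  obtain ⟨b, rfl⟩ := R.toLDualHom_surjective a
  refine freeLieAlgebra_subalgebra_eq_top (S.comap R.toLDualHom) ?_ b
  rintro (x | i | i)
  · exact hH x
  · exact hE i
  · exact hF i

section

attribute [local instance] LieRing.ofAssociativeRing

/-- The weight `x ↦ ⟨x, α̌_i⟩`. -/
def weight (i : Fin (ℓ + 1)) : Dual ℂ 𝔥 →ₗ[ℂ] ℂ := Dual.eval ℂ 𝔥 (R.coroot i)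

theorem weight_apply (i : Fin (ℓ + 1)) (x : Dual ℂ 𝔥) : R.weight i x = x (R.coroot i) := rfl

/-- The action of the free Lie algebra on the Verma module of highest weight `lam`. -/
def vermaHom (lam : Dual ℂ (Dual ℂ 𝔥)) :
    R.Free →ₗ⁅ℂ⁆ Module.End ℂ (FreeAlgebra ℂ (Fin (ℓ + 1))) :=
  FreeLieAlgebra.lift ℂ fun
    | Gen.H x => FreeVerma.cartan R.weight lam x
    | Gen.E i => FreeVerma.raise R.weight lam R.root i
    | Gen.F i => FreeVerma.lower i

theorem vermaHom_genH (lam : Dual ℂ (Dual ℂ 𝔥)) (x : Dual ℂ 𝔥) :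
    R.vermaHom lam (R.genH x) = FreeVerma.cartan R.weight lam x :=
  FreeLieAlgebra.lift_of_apply ..

theorem vermaHom_genE (lam : Dual ℂ (Dual ℂ 𝔥)) (i : Fin (ℓ + 1)) :
    R.vermaHom lam (R.genE i) = FreeVerma.raise R.weight lam R.root i :=
  FreeLieAlgebra.lift_of_apply ..

theorem vermaHom_genF (lam : Dual ℂ (Dual ℂ 𝔥)) (i : Fin (ℓ + 1)) :
    R.vermaHom lam (R.genF i) = FreeVerma.lower i :=
  FreeLieAlgebra.lift_of_apply ..

theorem lieHom_ad_pow {L L' : Type*} [LieRing L] [LieAlgebra ℂ L] [LieRing L'] [LieAlgebra ℂ L']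
    (g : L →ₗ⁅ℂ⁆ L') (x y : L) (n : ℕ) :
    g (((LieAlgebra.ad ℂ L x) ^ n) y) = ((LieAlgebra.ad ℂ L' (g x)) ^ n) (g y) := by
  induction n with
  | zero => simp
  | succ n ih =>
    rw [pow_succ', Module.End.mul_apply, LieAlgebra.ad_apply, LieHom.map_lie, ih, pow_succ',
      Module.End.mul_apply, LieAlgebra.ad_apply]

/-- The images of the negative Serre elements in the endomorphisms of a Verma module. -/
def serreLower : Set (Module.End ℂ (FreeAlgebra ℂ (Fin (ℓ + 1)))) :=
  {y | ∃ i j, i ≠ j ∧ y = ((LieAlgebra.ad ℂ _ (FreeVerma.lower i)) ^ (1 - C.A j i).toNat)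
    (FreeVerma.lower j)}

/-- Puts the Serre exponent in the form required by `ChevalleyRelations.lie_e_serre`. The last
clause is the symmetry of the zero pattern of A. -/
theorem exists_serre_exponent {i j : Fin (ℓ + 1)} (hij : i ≠ j) :
    ∃ n : ℕ, (1 - C.A j i).toNat = n + 1 ∧ R.root i (R.coroot j) = -n ∧
      (n = 0 → R.root j (R.coroot i) = 0) := by
  have h := C.off_diag j i hij.symm
  obtain ⟨n, hn⟩ := Int.eq_ofNat_of_zero_le (neg_nonneg.2 h)
  have hn' : C.A j i = -(n : ℤ) := by omega
  refine ⟨n, by omega, ?_, fun h0 => ?_⟩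
  · rw [R.root_coroot, hn']; simp
  · rw [R.root_coroot, (C.zero_iff j i).1 (by simp [hn', h0])]; simp

theorem root_coroot_self (i : Fin (ℓ + 1)) : R.root i (R.coroot i) = 2 := by
  rw [R.root_coroot, C.diag]; norm_num

/-- The operators spanned by iterated brackets of lowering operators with negative Serre
elements. -/
def serreSpan (C : AffineCartanMatrix ℓ) :
    Submodule ℂ (Module.End ℂ (FreeAlgebra ℂ (Fin (ℓ + 1)))) :=
  Submodule.span ℂ {y | IteratedBracket FreeVerma.lower (serreLower (C := C)) y}

theorem vermaHom_stabilizer (lam : Dual ℂ (Dual ℂ 𝔥)) (a : R.Free) :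
    R.vermaHom lam a ∈ stabilizer (serreSpan C) := by
  have D := FreeVerma.chevalleyRelations R.weight lam R.root
  have hH : ∀ y ∈ serreLower (C := C), ∀ x, ∃ t : ℂ,
      ⁅FreeVerma.cartan R.weight lam x, y⁆ = t • y := by
    rintro _ ⟨i, j, -, rfl⟩ x
    exact ⟨_, D.lie_h_ad_pow x i j _⟩
  refine freeLieAlgebra_subalgebra_eq_top ((stabilizer (serreSpan C)).comap (R.vermaHom lam)) ?_ a
  rintro (x | i | i) y hy
  · exact (congrArg (⁅·, y⁆ ∈ serreSpan C) (R.vermaHom_genH lam x)).mpr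
      (D.span_iteratedBracket_lie_h hH x hy)
  · refine (congrArg (⁅·, y⁆ ∈ serreSpan C) (R.vermaHom_genE lam i)).mpr
      (D.span_iteratedBracket_lie_e hH ?_ i hy)
    rintro _ ⟨i, j, hij, rfl⟩ k
    obtain ⟨n, h1, h2, h3⟩ := R.exists_serre_exponent hij
    rw [h1]
    exact D.lie_e_serre hij (R.root_coroot_self i) h2 h3 k
  · exact (congrArg (⁅·, y⁆ ∈ serreSpan C) (R.vermaHom_genF lam i)).mpr
      (span_iteratedBracket_lie_f _ _ i hy)

/-- All relators act by zero except the negative Serre elements, which are nonzero operators on the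
free algebra; `serreSpan` is there to absorb them. -/
theorem vermaHom_relator (lam : Dual ℂ (Dual ℂ 𝔥)) {y : R.Free} (hy : R.IsRelator y) :
    R.vermaHom lam y ∈ serreSpan C := by
  have D := FreeVerma.chevalleyRelations R.weight lam R.root
  cases hy with
  | H_add x y =>
    simp [vermaHom_genH, FreeVerma.cartan_add]
  | H_smul t x =>
    simp [vermaHom_genH, FreeVerma.cartan_smul]
  | H_H x y =>
    rw [LieHom.map_lie, vermaHom_genH, vermaHom_genH, D.h_h]
    exact zero_mem _
  | H_E x i =>
    rw [map_sub, map_smul, LieHom.map_lie, vermaHom_genH, vermaHom_genE, D.h_e, weight_apply,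
      sub_self]
    exact zero_mem _
  | H_F x i =>
    rw [map_add, map_smul, LieHom.map_lie, vermaHom_genH, vermaHom_genF, D.h_f, weight_apply,
      neg_add_cancel]
    exact zero_mem _
  | E_F i j =>
    rw [map_sub, LieHom.map_lie, vermaHom_genE, vermaHom_genF, D.e_f]
    split_ifs <;> simp [vermaHom_genH]
  | serre_E i j h =>
    have h0 : R.vermaHom lam (((LieAlgebra.ad ℂ R.Free (R.genE i)) ^ (1 - C.A j i).toNat)
        (R.genE j)) = 0 := by
      rw [lieHom_ad_pow, vermaHom_genE, vermaHom_genE]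
      -- The positive Serre element commutes with every lowering operator and kills 1.
      apply FreeVerma.eq_zero_of_commute
      · intro k
        obtain ⟨n, h1, h2, h3⟩ := R.exists_serre_exponent h
        rw [← lie_skew, h1, D.swap.lie_e_serre h (R.root_coroot_self i) h2 h3 k, neg_zero]
      · exact FreeVerma.ad_pow_raise_one R.weight lam R.root i j _
    rw [h0]
    exact zero_mem _
  | serre_F i j h =>
    rw [lieHom_ad_pow, vermaHom_genF, vermaHom_genF]
    exact Submodule.subset_span (IteratedBracket.base _ ⟨i, j, h, rfl⟩)

theorem vermaHom_relIdeal (lam : Dual ℂ (Dual ℂ 𝔥)) {y : R.Free} (hy : y ∈ R.relIdeal) :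
    R.vermaHom lam y ∈ serreSpan C := by
  let K : LieIdeal ℂ R.Free :=
    { (serreSpan C).comap (R.vermaHom lam : R.Free →ₗ[ℂ] _) with
      lie_mem := by
        intro a m hm
        change R.vermaHom lam ⁅a, m⁆ ∈ serreSpan C
        rw [LieHom.map_lie]
        exact R.vermaHom_stabilizer lam a _ hm }
  have hK : R.relIdeal ≤ K := by
    rw [relIdeal, LieSubmodule.lieSpan_le]
    intro y hy
    exact R.vermaHom_relator lam hy
  exact hK hy

/-- If `H x = 0`, then `genH x` lies in the ideal of relations, so on each Verma module it acts with
image in the augmentation ideal. It also sends 1 to `lam x`. Therefore `lam x = 0` for every highest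
weight `lam`. -/
theorem H_injective : Function.Injective R.H := by
  refine (injective_iff_map_eq_zero R.cartanMap).2 fun x hx => ?_
  refine (Module.forall_dual_apply_eq_zero_iff ℂ x).1 fun lam => ?_
  have h := R.vermaHom_relIdeal lam ((R.toLDualHom_eq_zero_iff (R.genH x)).1 hx)
  have h2 := FreeVerma.algebraMapInv_iteratedBracket (a := 1) ?_ h
  · rw [vermaHom_genH, FreeVerma.cartan_one, FreeAlgebra.algebraMap_leftInverse] at h2
    exact h2
  · rintro _ ⟨i, j, -, rfl⟩ a
    exact FreeVerma.algebraMapInv_ad_pow_lower i j _ a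

end

theorem linearIndependent_E : LinearIndependent ℂ R.E := by
  rw [Fintype.linearIndependent_iff]
  intro g hg j
  have h : ⁅∑ i, g i • R.E i, R.F j⁆ = g j • R.H (R.root j) := by
    simp [sum_lie, R.lie_E_F]
  rw [hg, zero_lie, ← H_smul] at h
  have h2 : g j • R.root j = 0 := R.H_injective (h.symm.trans R.cartanMap.map_zero.symm)
  exact (smul_eq_zero.1 h2).resolve_right (R.linearIndependent_root.ne_zero j)

end Realization

/-! ### Symmetrisability of affine Cartan matrices -/

namespace AffineCartanMatrix

variable {ℓ : ℕ} (C : AffineCartanMatrix ℓ)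

/-- The underlying simple graph of the Dynkin diagram. -/
def dynkinGraph : SimpleGraph (Fin (ℓ + 1)) where
  Adj i j := i ≠ j ∧ C.A i j ≠ 0
  symm := ⟨fun i j h => ⟨h.1.symm, fun h0 => h.2 ((C.zero_iff i j).2 h0)⟩⟩
  loopless := ⟨fun _ h => h.1 rfl⟩

theorem dynkinGraph_adj {i j : Fin (ℓ + 1)} : C.dynkinGraph.Adj i j ↔ i ≠ j ∧ C.A i j ≠ 0 :=
  Iff.rfl

theorem dynkinGraph_connected : C.dynkinGraph.Connected := by
  rw [SimpleGraph.connected_iff_exists_forall_reachable]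
  refine ⟨0, fun w => ?_⟩
  by_contra hw
  obtain ⟨i, hi, j, hj, hij⟩ := C.indecomposable {x | C.dynkinGraph.Reachable 0 x}
    ⟨0, SimpleGraph.Reachable.refl _⟩ ⟨w, hw⟩
  refine hj (SimpleGraph.Reachable.trans hi (SimpleGraph.Adj.reachable ⟨?_, hij⟩))
  rintro rfl
  exact hj hi

/-- The skew part of `(ǎ_i A_ij a_j)`. -/
def skewPart (i j : Fin (ℓ + 1)) : ℤ :=
  C.comark i * C.A i j * C.mark j - C.comark j * C.A j i * C.mark i

theorem skewPart_skew (i j : Fin (ℓ + 1)) : C.skewPart i j = -C.skewPart j i := by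
  simp [skewPart]

theorem sum_skewPart (i : Fin (ℓ + 1)) : ∑ j, C.skewPart i j = 0 := by
  simp only [skewPart, Finset.sum_sub_distrib]
  rw [← Finset.sum_mul, C.comark_mul, zero_mul, sub_zero]
  simp only [mul_assoc]
  rw [← Finset.mul_sum, C.mul_mark, mul_zero]

theorem skewPart_eq_zero_of_not_adj {i j : Fin (ℓ + 1)} (h : ¬C.dynkinGraph.Adj i j) :
    C.skewPart i j = 0 := by
  by_cases hij : i = j
  · subst hij; simp [skewPart]
  · have h0 : C.A i j = 0 := by
      by_contra h0
      exact h ⟨hij, h0⟩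
    simp [skewPart, h0, (C.zero_iff i j).1 h0]

/-- `skewPart` is a circulation on the Dynkin diagram: it is skew with zero net flow at each node.
The net flow out of the side of `i` is therefore zero, and the bridge is the only edge leaving that
side. -/
theorem skewPart_eq_zero_of_bridge {i j : Fin (ℓ + 1)}
    (h : ¬(C.dynkinGraph.deleteEdges {s(i, j)}).Reachable i j) : C.skewPart i j = 0 := by
  classical
  set X : Finset (Fin (ℓ + 1)) :=
    Finset.univ.filter fun x => (C.dynkinGraph.deleteEdges {s(i, j)}).Reachable i x with hX
  have hi : i ∈ X := by simp [hX]
  have hj : j ∈ Xᶜ := by simpa [hX] using h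
  have h1 : ∑ x ∈ X, ∑ y, C.skewPart x y = 0 :=
    Finset.sum_eq_zero fun x _ => C.sum_skewPart x
  have h2 : ∑ x ∈ X, ∑ y ∈ X, C.skewPart x y = 0 := by
    have h3 : ∑ x ∈ X, ∑ y ∈ X, C.skewPart x y = -∑ x ∈ X, ∑ y ∈ X, C.skewPart x y := by
      conv_lhs => rw [Finset.sum_comm]
      rw [← Finset.sum_neg_distrib]
      refine Finset.sum_congr rfl fun x _ => ?_
      rw [← Finset.sum_neg_distrib]
      exact Finset.sum_congr rfl fun y _ => C.skewPart_skew y x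
    omega
  have h4 : ∀ x ∈ X, ∀ y ∈ Xᶜ, C.skewPart x y ≠ 0 → x = i ∧ y = j := by
    intro x hx y hy hxy
    have hadj : C.dynkinGraph.Adj x y := by
      by_contra hn
      exact hxy (C.skewPart_eq_zero_of_not_adj hn)
    have hs : s(x, y) = s(i, j) := by
      by_contra hs
      simp only [hX, Finset.mem_compl, Finset.mem_filter, Finset.mem_univ, true_and] at hx hy
      refine hy (hx.trans (SimpleGraph.Adj.reachable ?_))
      rw [SimpleGraph.deleteEdges_adj]
      exact ⟨hadj, hs⟩
    rcases Sym2.eq_iff.1 hs with h | h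
    · exact h
    · rw [h.1] at hx
      exact absurd hx (Finset.mem_compl.1 hj)
  have h5 : ∑ x ∈ X, ∑ y ∈ Xᶜ, C.skewPart x y = C.skewPart i j := by
    rw [Finset.sum_eq_single_of_mem i hi, Finset.sum_eq_single_of_mem j hj]
    · intro y hy hyj
      by_contra hn
      exact hyj (h4 i hi y hy hn).2
    · intro x hx hxi
      refine Finset.sum_eq_zero fun y hy => ?_
      by_contra hn
      exact hxi (h4 x hx y hy hn).1
  simp only [← Finset.sum_add_sum_compl X, Finset.sum_add_distrib] at h1
  rw [h2, h5, zero_add] at h1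
  exact h1

/-- If the Dynkin diagram has at least as many edges as vertices, then all its edges are simple
and join nodes of equal weight for any positive null vector. -/
theorem eq_neg_one_of_card_le (A : Fin (ℓ + 1) → Fin (ℓ + 1) → ℤ) (G : SimpleGraph (Fin (ℓ + 1)))
    (hG : ∀ i j, G.Adj i j ↔ i ≠ j ∧ A i j ≠ 0) (hd : ∀ i, A i i = 2)
    (hoff : ∀ i j, i ≠ j → A i j ≤ 0) (a : Fin (ℓ + 1) → ℕ) (ha : ∀ i, 0 < a i)
    (hA : ∀ i, ∑ j, A i j * (a j : ℤ) = 0) (hcard : ℓ + 1 ≤ Nat.card G.edgeSet)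
    {i j : Fin (ℓ + 1)} (hij : G.Adj i j) : A i j = -1 ∧ a i = a j := by
  classical
  have hpos : ∀ i, (0 : ℝ) < a i := fun i => by exact_mod_cast ha i
  -- Conjugation by the null vector makes the off-diagonal row sums equal to 2 and leaves the
  -- products A_ij A_ji unchanged.
  set b : Fin (ℓ + 1) → Fin (ℓ + 1) → ℝ := fun i j => -((A i j : ℝ) * a j / a i) with hb
  set W : Finset (Fin (ℓ + 1) × Fin (ℓ + 1)) :=
    Finset.univ.filter fun p => G.Adj p.1 p.2 with hW
  have hle : ∀ i j, G.Adj i j → (A i j : ℝ) ≤ -1 := by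
    intro i j h
    have h1 := (hG i j).1 h
    have h2 := hoff i j h1.1
    have h3 : A i j ≤ -1 := by have := h1.2; omega
    exact_mod_cast h3
  have hbpos : ∀ i j, G.Adj i j → 0 < b i j := by
    intro i j h
    have h1 : 0 < -(A i j : ℝ) := by linarith [hle i j h]
    have : b i j = -(A i j : ℝ) * a j / a i := by simp only [hb]; ring
    rw [this]
    exact div_pos (mul_pos h1 (hpos j)) (hpos i)
  have hprod : ∀ i j, b i j * b j i = (A i j : ℝ) * A j i := by
    intro i j
    have := (hpos i).ne'
    have := (hpos j).ne'
    simp only [hb]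
    field_simp
  have hprod1 : ∀ i j, G.Adj i j → 1 ≤ b i j * b j i := by
    intro i j h
    rw [hprod]
    nlinarith [hle i j h, hle j i h.symm]
  have hrow : ∀ i, ∑ j with G.Adj i j, b i j = 2 := by
    intro i
    have h1 : ∑ j, b i j = 0 := by
      simp only [hb, Finset.sum_neg_distrib, ← Finset.sum_div]
      have := hA i
      have h2 : ((∑ j, A i j * (a j : ℤ) : ℤ) : ℝ) = 0 := by rw [this]; simp
      push_cast at h2
      rw [h2]
      simp
    have h3 : ∑ j ∈ Finset.univ.erase i, b i j = 2 := by
      have h4 := Finset.add_sum_erase Finset.univ (b i) (Finset.mem_univ i)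
      have h5 : b i i = -2 := by
        have := (hpos i).ne'
        simp only [hb, hd]
        field_simp
        norm_num
      linarith
    rw [← h3]
    refine Finset.sum_subset_zero_on_sdiff ?_ ?_ fun _ _ => rfl
    · intro j hj
      simp only [Finset.mem_filter, Finset.mem_univ, true_and] at hj
      simp [hj.ne']
    · intro j hj
      simp only [Finset.mem_sdiff, Finset.mem_erase, Finset.mem_filter, Finset.mem_univ, true_and,
        and_true] at hj
      have h0 : A i j = 0 := by
        by_contra h0
        exact hj.2 ((hG i j).2 ⟨hj.1.symm, h0⟩)
      simp [hb, h0]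
  have hsum : ∑ p ∈ W, b p.1 p.2 = 2 * (ℓ + 1) := by
    rw [hW, Finset.sum_filter, ← Finset.univ_product_univ, Finset.sum_product]
    simp only [← Finset.sum_filter, hrow]
    simp; ring
  have hsum' : ∑ p ∈ W, b p.2 p.1 = 2 * (ℓ + 1) := by
    rw [← hsum]
    refine Finset.sum_nbij' Prod.swap Prod.swap ?_ ?_ ?_ ?_ ?_
    all_goals simp [hW, G.adj_comm]
  have hcardW : 2 * (ℓ + 1) ≤ W.card := by
    have h1 : W.card = 2 * G.edgeFinset.card := by
      rw [← SimpleGraph.sum_degrees_eq_twice_card_edges, hW, Finset.card_filter,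
        ← Finset.univ_product_univ, Finset.sum_product]
      refine Finset.sum_congr rfl fun x _ => ?_
      rw [← Finset.card_filter, ← SimpleGraph.card_neighborFinset_eq_degree,
        SimpleGraph.neighborFinset_eq_filter]
    rw [Nat.card_eq_fintype_card, ← SimpleGraph.edgeFinset_card] at hcard
    omega
  -- The arithmetic-geometric mean inequality, as b_ij b_ji ≥ 1.
  have hge : ∀ p ∈ W, 0 ≤ b p.1 p.2 + b p.2 p.1 - 2 := by
    intro p hp
    have hp' : G.Adj p.1 p.2 := by simpa [hW] using hp
    nlinarith [hbpos _ _ hp', hbpos _ _ hp'.symm, hprod1 _ _ hp',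
      sq_nonneg (b p.1 p.2 - b p.2 p.1)]
  -- The sum is 4(ℓ+1) - 2|W|, and |W| is twice the number of edges. Equality must then hold in
  -- every term.
  have htot : ∑ p ∈ W, (b p.1 p.2 + b p.2 p.1 - 2) ≤ 0 := by
    rw [Finset.sum_sub_distrib, Finset.sum_add_distrib, hsum, hsum', Finset.sum_const,
      nsmul_eq_mul]
    have : (2 * (ℓ + 1) : ℝ) ≤ W.card := by exact_mod_cast hcardW
    linarith
  have hzero := (Finset.sum_eq_zero_iff_of_nonneg hge).1
    (le_antisymm htot (Finset.sum_nonneg hge)) (i, j) (by simp [hW, hij])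
  simp only at hzero
  have hp := hprod1 i j hij
  have hb1 : b i j = 1 := by nlinarith [sq_nonneg (b i j - 1)]
  have hb2 : b j i = 1 := by linarith
  have hAA : (A i j : ℝ) * A j i = 1 := by rw [← hprod, hb1, hb2, one_mul]
  have hAij : (A i j : ℝ) = -1 := by nlinarith [hle i j hij, hle j i hij.symm]
  refine ⟨by exact_mod_cast hAij, ?_⟩
  simp only [hb, hAij] at hb1
  have := (hpos i).ne'
  field_simp at hb1
  have h6 : (a i : ℝ) = a j := by linarith
  exact_mod_cast h6

/-- A bridge carries no circulation. An edge that is not a bridge forces at least ℓ + 1 edges, since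
the diagram stays connected without it; `eq_neg_one_of_card_le`, applied to A and to its transpose,
then makes the two terms of `skewPart` equal. -/
theorem skewPart_eq_zero (i j : Fin (ℓ + 1)) : C.skewPart i j = 0 := by
  classical
  by_cases hadj : C.dynkinGraph.Adj i j
  swap
  · exact C.skewPart_eq_zero_of_not_adj hadj
  by_cases hb : (C.dynkinGraph.deleteEdges {s(i, j)}).Reachable i j
  swap
  · exact C.skewPart_eq_zero_of_bridge hb
  have hconn : (C.dynkinGraph.deleteEdges {s(i, j)}).Connected := by
    apply C.dynkinGraph_connected.connected_delete_edge_of_not_isBridge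
    rw [SimpleGraph.isBridge_iff]
    exact fun h => h hb
  have hcard : ℓ + 1 ≤ Nat.card C.dynkinGraph.edgeSet := by
    have h1 := hconn.card_vert_le_card_edgeSet_add_one
    rw [Nat.card_eq_fintype_card, Fintype.card_fin] at h1
    have h2 : Nat.card (C.dynkinGraph.deleteEdges {s(i, j)}).edgeSet
        < Nat.card C.dynkinGraph.edgeSet := by
      simp only [Nat.card_eq_fintype_card, ← SimpleGraph.edgeFinset_card]
      apply Finset.card_lt_card
      rw [SimpleGraph.edgeFinset_ssubset_edgeFinset]
      refine lt_of_le_of_ne (SimpleGraph.deleteEdges_le _) fun h => ?_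
      rw [← h, SimpleGraph.deleteEdges_adj] at hadj
      exact hadj.2 rfl
    omega
  have h1 := eq_neg_one_of_card_le C.A C.dynkinGraph (fun _ _ => Iff.rfl) C.diag C.off_diag C.mark
    C.mark_pos C.mul_mark hcard hadj
  have h2 := eq_neg_one_of_card_le (fun i j => C.A j i) C.dynkinGraph
    (fun i j => by rw [dynkinGraph_adj, Ne, Ne, Ne, C.zero_iff i j]) C.diag
    (fun i j h => C.off_diag j i h.symm) C.comark
    C.comark_pos (fun i => by simpa [mul_comm] using C.comark_mul i) hcard hadj
  simp only [skewPart, h1.1, h2.1, h1.2, h2.2]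
  ring

/-- The matrix `(ǎ_i A_ij a_j)` is symmetric. -/
theorem comark_mul_mark_symm (i j : Fin (ℓ + 1)) :
    (C.comark i * C.A i j * C.mark j : ℂ) = C.comark j * C.A j i * C.mark i := by
  have h := C.skewPart_eq_zero i j
  rw [skewPart, sub_eq_zero] at h
  exact_mod_cast h

theorem mark_ne_zero (i : Fin (ℓ + 1)) : (C.mark i : ℂ) ≠ 0 := by
  exact_mod_cast (C.mark_pos i).ne'

theorem comark_ne_zero (i : Fin (ℓ + 1)) : (C.comark i : ℂ) ≠ 0 := by
  exact_mod_cast (C.comark_pos i).ne'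

/-- The ratio `ǎ_i / a_i`. -/
def markRatio (i : Fin (ℓ + 1)) : ℂ := C.comark i / C.mark i

theorem markRatio_symm (i j : Fin (ℓ + 1)) :
    C.markRatio i * C.A i j = C.markRatio j * C.A j i := by
  have h := C.comark_mul_mark_symm i j
  have := C.mark_ne_zero i
  have := C.mark_ne_zero j
  rw [markRatio, markRatio]
  field_simp
  linear_combination h

end AffineCartanMatrix

/-! ### The symmetric form on the dual of the Cartan subalgebra -/

namespace Realization

variable {ℓ : ℕ} {C : AffineCartanMatrix ℓ} {𝔥 : Type*} [AddCommGroup 𝔥] [Module ℂ 𝔥]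
  (R : Realization C 𝔥)

theorem form_symm (x y : 𝔥) : R.form x y = R.form y x := by
  have h : R.form = R.form.flip := by
    refine R.cartanBasis.ext fun i => R.cartanBasis.ext fun j => ?_
    rw [LinearMap.flip_apply]
    rcases i with _ | i <;> rcases j with _ | j
    · rfl
    · rw [R.cartanBasis_none, R.cartanBasis_some, R.form_d_coroot, R.form_coroot]
    · rw [R.cartanBasis_none, R.cartanBasis_some, R.form_d_coroot, R.form_coroot]
    · rw [R.cartanBasis_some, R.cartanBasis_some, R.form_coroot, R.form_coroot, R.root_coroot,
        R.root_coroot]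
      have h := C.comark_mul_mark_symm i j
      have := C.comark_ne_zero i
      have := C.comark_ne_zero j
      field_simp
      linear_combination -h
  exact LinearMap.congr_fun (LinearMap.congr_fun h x) y

theorem nu_apply (x : 𝔥) : R.nu x = R.form x := rfl

/-- The form `(·|·)` on `𝔥*` as a bilinear form. -/
def dualBilin : LinearMap.BilinForm ℂ (Dual ℂ 𝔥) :=
  R.form.compl₁₂ R.nu.symm.toLinearMap R.nu.symm.toLinearMap

theorem dualBilin_apply (x y : Dual ℂ 𝔥) : R.dualBilin x y = R.dualForm x y := rfl

theorem dualForm_symm (x y : Dual ℂ 𝔥) : R.dualForm x y = R.dualForm y x := R.form_symm _ _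

/-- Under ν the root α_i corresponds to (ǎ_i/a_i) α̌_i. -/
theorem dualForm_root (i : Fin (ℓ + 1)) (y : Dual ℂ 𝔥) :
    R.dualForm (R.root i) y = C.markRatio i * y (R.coroot i) := by
  have h : R.root i = R.nu (C.markRatio i • R.coroot i) := by
    ext x
    have := C.mark_ne_zero i
    have := C.comark_ne_zero i
    rw [map_smul, LinearMap.smul_apply, nu_apply, form_coroot, AffineCartanMatrix.markRatio,
      smul_eq_mul]
    field_simp
  have h2 : y = R.form (R.nu.symm y) := (R.nu.apply_symm_apply y).symm
  rw [dualForm, h, LinearEquiv.symm_apply_apply, R.form_symm]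
  conv_rhs => rw [h2]
  rw [map_smul, smul_eq_mul]

theorem dualForm_root_self (i : Fin (ℓ + 1)) :
    R.dualForm (R.root i) (R.root i) = 2 * C.markRatio i := by
  rw [R.dualForm_root, R.root_coroot_self, mul_comm]

end Realization

/-! ### Triangular decomposition -/

/-- The iterated brackets of `n` elements among the `e i`. -/
inductive Monomial {ι L : Type*} [LieRing L] (e : ι → L) : ℕ → L → Prop
  | gen (i : ι) : Monomial e 1 (e i)
  | lie (i : ι) (n : ℕ) (y : L) : Monomial e n y → Monomial e (n + 1) ⁅e i, y⁆

section

variable {ι L : Type*} [LieRing L] {e : ι → L}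

theorem Monomial.pos {n : ℕ} {y : L} (h : Monomial e n y) : 1 ≤ n := by
  cases h <;> omega

theorem Monomial.eq_of_one {y : L} (h : Monomial e 1 y) : ∃ i, y = e i := by
  cases h with
  | gen i => exact ⟨i, rfl⟩
  | lie i n y h => exact absurd h.pos (by omega)

theorem Monomial.eq_of_two {y : L} (h : Monomial e 2 y) : ∃ i j, y = ⁅e i, e j⁆ := by
  cases h with
  | lie i n y h =>
    obtain ⟨j, rfl⟩ := h.eq_of_one
    exact ⟨i, j, rfl⟩

variable [LieAlgebra ℂ L]

/-- The span of the iterated brackets of the `e i`. -/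
def monomialSpan (e : ι → L) : Submodule ℂ L := Submodule.span ℂ {y | ∃ n, Monomial e n y}

theorem lie_mem_monomialSpan (i : ι) {y : L} (hy : y ∈ monomialSpan e) :
    ⁅e i, y⁆ ∈ monomialSpan e := by
  rw [monomialSpan] at hy ⊢
  induction hy using Submodule.span_induction with
  | mem y hy =>
    obtain ⟨n, hn⟩ := hy
    exact Submodule.subset_span ⟨_, hn.lie i n y⟩
  | zero => simp
  | add x y _ _ hx hy => rw [lie_add]; exact add_mem hx hy
  | smul t x _ hx => rw [lie_smul]; exact Submodule.smul_mem _ _ hx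

theorem span_range_neg {V : Type*} (h : V → L) :
    Submodule.span ℂ (Set.range fun x => -h x) = Submodule.span ℂ (Set.range h) := by
  have hr : (Set.range fun x => -h x) = -Set.range h := by
    ext y
    simp [Set.mem_range, neg_eq_iff_eq_neg]
  rw [hr, Submodule.span_neg]

/-- The sum of the three parts of the triangular decomposition. -/
def triangularSpan {V : Type*} (h : V → L) (e f : ι → L) : Submodule ℂ L :=
  monomialSpan e ⊔ Submodule.span ℂ (Set.range h) ⊔ monomialSpan f

theorem triangularSpan_swap {V : Type*} (h : V → L) (e f : ι → L) :
    triangularSpan (fun x => -h x) f e = triangularSpan h e f := by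
  rw [triangularSpan, triangularSpan, span_range_neg, sup_comm, sup_comm (monomialSpan f),
    sup_assoc]

end

namespace ChevalleyRelations

variable {ι V L : Type*} [DecidableEq ι] [AddCommGroup V] [Module ℂ V]
    [LieRing L] [LieAlgebra ℂ L] {wt : ι → V → ℂ} {root : ι → V} {h : V → L} {e f : ι → L}

theorem exists_weight_monomial (D : ChevalleyRelations wt root h e f) (x : V) {n : ℕ} {y : L}
    (hy : Monomial e n y) : ∃ t : ℂ, ⁅h x, y⁆ = t • y ∧ ((∀ i, wt i x = 1) → t = n) := by
  induction hy with
  | gen i => exact ⟨wt i x, D.h_e x i, fun hx => by simp [hx]⟩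
  | lie i n y _ ih =>
    obtain ⟨t, ht, ht'⟩ := ih
    refine ⟨wt i x + t, ?_, fun hx => ?_⟩
    · rw [leibniz_lie, D.h_e, ht, smul_lie, lie_smul, add_smul]
    · rw [ht' hx, hx]; push_cast; ring

theorem lie_h_mem_monomialSpan (D : ChevalleyRelations wt root h e f) (x : V) {y : L}
    (hy : y ∈ monomialSpan e) : ⁅h x, y⁆ ∈ monomialSpan e := by
  rw [monomialSpan] at hy ⊢
  induction hy using Submodule.span_induction with
  | mem y hy =>
    obtain ⟨n, hn⟩ := hy
    obtain ⟨t, ht, -⟩ := D.exists_weight_monomial x hn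
    rw [ht]
    exact Submodule.smul_mem _ _ (Submodule.subset_span ⟨n, hn⟩)
  | zero => simp
  | add x y _ _ hx hy => rw [lie_add]; exact add_mem hx hy
  | smul t x _ hx => rw [lie_smul]; exact Submodule.smul_mem _ _ hx

theorem lie_e_mem_of_mem_cartan (D : ChevalleyRelations wt root h e f) (i : ι) {y : L}
    (hy : y ∈ Submodule.span ℂ (Set.range h)) : ⁅e i, y⁆ ∈ monomialSpan e := by
  induction hy using Submodule.span_induction with
  | mem y hy =>
    obtain ⟨x, rfl⟩ := hy
    rw [← lie_skew, D.h_e]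
    exact neg_mem (Submodule.smul_mem _ _ (Submodule.subset_span ⟨1, Monomial.gen i⟩))
  | zero => simp
  | add x y _ _ hx hy => rw [lie_add]; exact add_mem hx hy
  | smul t x _ hx => rw [lie_smul]; exact Submodule.smul_mem _ _ hx

theorem lie_f_mem (D : ChevalleyRelations wt root h e f) (k : ι) {y : L}
    (hy : y ∈ monomialSpan e) : ⁅f k, y⁆ ∈ monomialSpan e ⊔ Submodule.span ℂ (Set.range h) := by
  have hef : ∀ i, ⁅f k, e i⁆ = if i = k then -h (root i) else 0 := by
    intro i
    rw [← lie_skew, D.e_f]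
    split_ifs <;> simp
  rw [monomialSpan] at hy
  induction hy using Submodule.span_induction with
  | mem y hy =>
    obtain ⟨n, hn⟩ := hy
    induction hn with
    | gen i =>
      rw [hef]
      split_ifs
      · exact neg_mem (Submodule.mem_sup_right (Submodule.subset_span ⟨_, rfl⟩))
      · exact zero_mem _
    | lie i n y hn ih =>
      rw [leibniz_lie, hef]
      refine add_mem ?_ (Submodule.mem_sup_left ?_)
      · split_ifs
        · rw [neg_lie]
          exact neg_mem (Submodule.mem_sup_left
            (D.lie_h_mem_monomialSpan _ (Submodule.subset_span ⟨n, hn⟩)))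
        · simp
      · obtain ⟨p, hp, q, hq, hpq⟩ := Submodule.mem_sup.1 ih
        rw [← hpq, lie_add]
        exact add_mem (lie_mem_monomialSpan i hp) (D.lie_e_mem_of_mem_cartan i hq)
  | zero => simp
  | add x y _ _ hx hy => rw [lie_add]; exact add_mem hx hy
  | smul t x _ hx => rw [lie_smul]; exact Submodule.smul_mem _ _ hx

theorem e_mem_stabilizer (D : ChevalleyRelations wt root h e f) (i : ι) :
    e i ∈ stabilizer (triangularSpan h e f) := by
  intro y hy
  obtain ⟨p, hp, q, hq, rfl⟩ := Submodule.mem_sup.1 hy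
  obtain ⟨s, hs, r, hr, rfl⟩ := Submodule.mem_sup.1 hp
  rw [lie_add, lie_add]
  refine add_mem (add_mem ?_ ?_) ?_
  · exact Submodule.mem_sup_left (Submodule.mem_sup_left (lie_mem_monomialSpan i hs))
  · exact Submodule.mem_sup_left (Submodule.mem_sup_left (D.lie_e_mem_of_mem_cartan i hr))
  · have h1 := D.swap.lie_f_mem i hq
    rw [span_range_neg] at h1
    refine (?_ : monomialSpan f ⊔ Submodule.span ℂ (Set.range h) ≤ triangularSpan h e f) h1
    exact sup_le le_sup_right (le_sup_right.trans le_sup_left)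

theorem lie_h_of_mem_cartan (D : ChevalleyRelations wt root h e f) (x : V) {y : L}
    (hy : y ∈ Submodule.span ℂ (Set.range h)) : ⁅h x, y⁆ = 0 := by
  induction hy using Submodule.span_induction with
  | mem y hy => obtain ⟨x', rfl⟩ := hy; exact D.h_h x x'
  | zero => simp
  | add y z _ _ hy hz => rw [lie_add, hy, hz, add_zero]
  | smul t y _ hy => rw [lie_smul, hy, smul_zero]

theorem h_mem_stabilizer (D : ChevalleyRelations wt root h e f) (x : V) :
    h x ∈ stabilizer (triangularSpan h e f) := by
  intro y hy
  obtain ⟨p, hp, q, hq, rfl⟩ := Submodule.mem_sup.1 hy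
  obtain ⟨s, hs, r, hr, rfl⟩ := Submodule.mem_sup.1 hp
  rw [lie_add, lie_add]
  refine add_mem (add_mem ?_ ?_) ?_
  · exact Submodule.mem_sup_left (Submodule.mem_sup_left (D.lie_h_mem_monomialSpan x hs))
  · rw [D.lie_h_of_mem_cartan x hr]
    exact zero_mem _
  · have h1 := D.swap.lie_h_mem_monomialSpan x hq
    rw [neg_lie, neg_mem_iff] at h1
    exact Submodule.mem_sup_right h1

end ChevalleyRelations

/-- If a space is spanned by eigenvectors of `T` satisfying a predicate `P`, then each eigenspace
is spanned by the eigenvectors in it that satisfy `P`. -/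
theorem mem_span_of_eigenvector {M : Type*} [AddCommGroup M] [Module ℂ M] (T : Module.End ℂ M)
    (P : ℤ → M → Prop) (hP : ∀ n y, P n y → T y = (n : ℂ) • y)
    (htop : ∀ x, x ∈ Submodule.span ℂ {y | ∃ n, P n y}) {n : ℤ} {x : M}
    (hx : T x = (n : ℂ) • x) : x ∈ Submodule.span ℂ {y | P n y} := by
  have hind : iSupIndep fun m : ℤ => T.eigenspace (m : ℂ) :=
    T.eigenspaces_iSupIndep.comp Int.cast_injective
  have hle : ∀ m, Submodule.span ℂ {y | P m y} ≤ T.eigenspace (m : ℂ) := fun m =>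
    Submodule.span_le.2 fun y hy => Module.End.mem_eigenspace_iff.2 (hP m y hy)
  -- The component of `x` in the other eigenspaces is again an eigenvector for `n`, so independence
  -- of eigenspaces kills it.
  have h1 : x ∈ Submodule.span ℂ {y | P n y} ⊔ ⨆ (m : ℤ) (_ : m ≠ n), T.eigenspace (m : ℂ) := by
    refine (Submodule.span_le.2 ?_ : Submodule.span ℂ {y | ∃ n, P n y} ≤ _) (htop x)
    rintro y ⟨m, hm⟩
    by_cases hmn : m = n
    · subst hmn
      exact Submodule.mem_sup_left (Submodule.subset_span hm)
    · exact Submodule.mem_sup_right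
        (Submodule.mem_iSup_of_mem m (Submodule.mem_iSup_of_mem hmn
          (hle m (Submodule.subset_span hm))))
  obtain ⟨s, hs, t, ht, rfl⟩ := Submodule.mem_sup.1 h1
  have ht' : t ∈ T.eigenspace (n : ℂ) := by
    have := sub_mem (Module.End.mem_eigenspace_iff.2 hx) (hle n hs)
    simpa using this
  have h0 : t = 0 := (Submodule.disjoint_def.1 (hind n)) t ht' ht
  rw [h0, add_zero]
  exact hs

namespace Realization

variable {ℓ : ℕ} {C : AffineCartanMatrix ℓ} {𝔥 : Type*} [AddCommGroup 𝔥] [Module ℂ 𝔥]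
  (R : Realization C 𝔥)

/-- The sum of the three parts is stable under the generators, hence under the whole algebra. It is
thus a subalgebra, and it contains the generators. -/
theorem mem_triangularSpan (y : R.LDual) :
    y ∈ triangularSpan R.H R.E R.F := by
  set S := triangularSpan R.H R.E R.F with hS
  have D := R.chevalleyRelations
  have hF : ∀ i, R.F i ∈ stabilizer S := by
    intro i
    have := D.swap.e_mem_stabilizer i
    rwa [triangularSpan_swap] at this
  have hst : ∀ a, a ∈ stabilizer S :=
    R.subalgebra_eq_top _ D.h_mem_stabilizer D.e_mem_stabilizer hF
  refine R.subalgebra_eq_top { S with lie_mem' := fun {a b} _ hb => hst a b hb } ?_ ?_ ?_ y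
  · exact fun x => Submodule.mem_sup_left
      (Submodule.mem_sup_right (Submodule.subset_span ⟨x, rfl⟩))
  · exact fun i => Submodule.mem_sup_left
      (Submodule.mem_sup_left (Submodule.subset_span ⟨1, Monomial.gen i⟩))
  · exact fun i => Submodule.mem_sup_right (Submodule.subset_span ⟨1, Monomial.gen i⟩)

/-- The monomial spanning set of `ᴸ𝔤`, with its principal degree. -/
inductive DegMonomial : ℤ → R.LDual → Prop
  | pos (n : ℕ) (y : R.LDual) : Monomial R.E n y → DegMonomial n y
  | cartan (x : Dual ℂ 𝔥) : DegMonomial 0 (R.H x)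
  | neg (n : ℕ) (y : R.LDual) : Monomial R.F n y → DegMonomial (-n) y

theorem mem_span_degMonomial (y : R.LDual) :
    y ∈ Submodule.span ℂ {y | ∃ n, R.DegMonomial n y} := by
  refine (sup_le (sup_le ?_ ?_) ?_ : triangularSpan R.H R.E R.F ≤ _)
    (R.mem_triangularSpan y)
  · exact Submodule.span_mono fun y ⟨n, hn⟩ => ⟨n, DegMonomial.pos n y hn⟩
  · exact Submodule.span_mono fun y ⟨x, hx⟩ => ⟨0, hx ▸ DegMonomial.cartan x⟩
  · exact Submodule.span_mono fun y ⟨n, hn⟩ => ⟨-n, DegMonomial.neg n y hn⟩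

variable {R} {ρ : Dual ℂ 𝔥}

theorem DegMonomial.lie_rho (hρ : ∀ i, ρ (R.coroot i) = 1) {n : ℤ} {y : R.LDual}
    (h : R.DegMonomial n y) : ⁅R.H ρ, y⁆ = (n : ℂ) • y := by
  cases h with
  | pos n _ h =>
    obtain ⟨t, ht, ht'⟩ := R.chevalleyRelations.exists_weight_monomial ρ h
    rw [ht, ht' hρ]
    simp
  | cartan x => simp [R.lie_H_H]
  | neg n _ h =>
    obtain ⟨t, ht, ht'⟩ := R.chevalleyRelations.swap.exists_weight_monomial ρ h
    rw [neg_lie, neg_eq_iff_eq_neg] at ht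
    rw [ht, ht' hρ]
    simp

/-- Since ρ is 1 on every simple coroot, ad ρ measures the height, and degree n lies in its
n-eigenspace. -/
theorem mem_span_of_mem_graded (hρ : ∀ i, ρ (R.coroot i) = 1) {n : ℤ} {y : R.LDual}
    (hy : y ∈ R.graded n) : y ∈ Submodule.span ℂ {y | R.DegMonomial n y} := by
  refine mem_span_of_eigenvector (LieAlgebra.ad ℂ R.LDual (R.H ρ)) R.DegMonomial
    (fun n y h => h.lie_rho hρ) R.mem_span_degMonomial ?_
  rw [← Module.End.mem_eigenspace_iff]
  refine (iSup₂_le fun r hr => ?_ : R.graded n ≤ _) hy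
  intro x hx
  rw [Module.End.mem_eigenspace_iff, LieAlgebra.ad_apply, hx ρ, ← hr, map_sum]
  simp [hρ]

theorem graded_one_le (hρ : ∀ i, ρ (R.coroot i) = 1) :
    R.graded 1 ≤ Submodule.span ℂ (Set.range R.E) := by
  intro y hy
  refine Submodule.span_mono ?_ (mem_span_of_mem_graded hρ hy)
  rintro y hy
  generalize hn : (1 : ℤ) = n at hy
  cases hy with
  | pos n _ h =>
    obtain rfl : n = 1 := by omega
    obtain ⟨i, rfl⟩ := h.eq_of_one
    exact ⟨i, rfl⟩
  | cartan x => omega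
  | neg n _ h => omega

theorem graded_two_le (hρ : ∀ i, ρ (R.coroot i) = 1) :
    R.graded 2 ≤ Submodule.span ℂ (Set.range fun p : Fin (ℓ + 1) × Fin (ℓ + 1) =>
      ⁅R.E p.1, R.E p.2⁆) := by
  intro y hy
  refine Submodule.span_mono ?_ (mem_span_of_mem_graded hρ hy)
  rintro y hy
  generalize hn : (2 : ℤ) = n at hy
  cases hy with
  | pos n _ h =>
    obtain rfl : n = 2 := by omega
    obtain ⟨i, j, rfl⟩ := h.eq_of_two
    exact ⟨(i, j), rfl⟩
  | cartan x => omega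
  | neg n _ h => omega

theorem lie_E_pNegOne (i : Fin (ℓ + 1)) : ⁅R.E i, R.pNegOne⁆ = R.H (R.root i) := by
  simp [pNegOne, lie_sum, R.lie_E_F]

theorem principal_one_le (hρ : ∀ i, ρ (R.coroot i) = 1) :
    R.principal 1 ≤ Submodule.span ℂ {R.pOne} := by
  rintro y ⟨hy, hy'⟩
  obtain ⟨g, rfl⟩ := (Submodule.mem_span_range_iff_exists_fun ℂ).1 (graded_one_le hρ hy)
  obtain ⟨t, ht⟩ := Submodule.mem_span_singleton.1 hy'
  rw [LieAlgebra.ad_apply, ← lie_skew, sum_lie] at ht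
  simp only [smul_lie, lie_E_pNegOne] at ht
  have h : R.cartanMap (∑ i, (t * C.mark i + g i) • R.root i) = 0 := by
    simp only [add_smul, Finset.sum_add_distrib, map_add, map_sum, map_smul, mul_smul,
      ← Finset.smul_sum, cartanMap_apply]
    have h2 : R.H R.delta = ∑ i, (C.mark i : ℂ) • R.H (R.root i) := by
      change R.cartanMap R.delta = _
      rw [delta, map_sum]
      simp only [map_smul, cartanMap_apply]
    rw [← h2, ht, neg_add_cancel]
  have h3 := (injective_iff_map_eq_zero R.cartanMap).1 R.H_injective _ h
  have h4 := Fintype.linearIndependent_iff.1 R.linearIndependent_root _ h3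
  -- From [p_{-1}, ∑ g_i ě_i] = -∑ g_i α_i = t δ, independence of the roots gives g_i = -t a_i.
  refine Submodule.mem_span_singleton.2 ⟨-t, ?_⟩
  rw [pOne, Finset.smul_sum]
  refine Finset.sum_congr rfl fun i _ => ?_
  rw [smul_smul]
  congr 1
  linear_combination -h4 i

/-! ### Pairing with the cyclic element -/

variable (R)

/-- Only the degree-one part of the invariant form is used, so the values are prescribed on the
independent ě_i and extended arbitrarily. -/
theorem exists_functional : ∃ f : R.LDual →ₗ[ℂ] ℂ, ∀ i, f (R.E i) = C.markRatio i := by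
  obtain ⟨f, hf⟩ := LinearMap.exists_extend
    ((Module.Basis.span R.linearIndependent_E).constr ℂ C.markRatio)
  refine ⟨f, fun i => ?_⟩
  have h := LinearMap.congr_fun hf (Module.Basis.span R.linearIndependent_E i)
  rw [Module.Basis.constr_basis, LinearMap.comp_apply, Submodule.subtype_apply,
    Module.Basis.span_apply] at h
  exact h

/-- A functional on `ᴸ𝔤` that restricts to `(p_{-1} | ·)` in degree one. -/
def cyclicFunctional : R.LDual →ₗ[ℂ] ℂ := R.exists_functional.choose

theorem cyclicFunctional_E (i : Fin (ℓ + 1)) : R.cyclicFunctional (R.E i) = C.markRatio i :=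
  R.exists_functional.choose_spec i

theorem cyclicFunctional_pOne : R.cyclicFunctional R.pOne = C.dualCoxeter := by
  rw [pOne, map_sum, AffineCartanMatrix.dualCoxeter]
  push_cast
  refine Finset.sum_congr rfl fun i _ => ?_
  have := C.mark_ne_zero i
  rw [map_smul, R.cyclicFunctional_E, AffineCartanMatrix.markRatio, smul_eq_mul]
  field_simp

theorem lie_lie_E_pNegOne (i j : Fin (ℓ + 1)) :
    ⁅⁅R.E i, R.E j⁆, R.pNegOne⁆ = -((C.A i j : ℂ) • R.E i) + (C.A j i : ℂ) • R.E j := by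
  rw [lie_lie, lie_E_pNegOne, lie_E_pNegOne, ← lie_skew, R.lie_H_E, ← lie_skew, R.lie_H_E,
    R.root_coroot, R.root_coroot, sub_neg_eq_add]

/-- Invariance would give (p_{-1} | [y, p_{-1}]) = 0. On y = [ě_i, ě_j] this reduces to (ǎ_i/a_i)
A_ij = (ǎ_j/a_j) A_ji. -/
theorem cyclicFunctional_lie_pNegOne (hρ : ∀ i, ρ (R.coroot i) = 1) {y : R.LDual}
    (hy : y ∈ R.graded 2) : R.cyclicFunctional ⁅y, R.pNegOne⁆ = 0 := by
  have hy' := graded_two_le hρ hy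
  clear hy
  induction hy' using Submodule.span_induction with
  | mem y hy =>
    obtain ⟨⟨i, j⟩, rfl⟩ := hy
    rw [R.lie_lie_E_pNegOne, map_add, map_neg, map_smul, map_smul, R.cyclicFunctional_E,
      R.cyclicFunctional_E, smul_eq_mul, smul_eq_mul]
    linear_combination -C.markRatio_symm i j
  | zero => simp
  | add x y _ _ hx hy => rw [add_lie, map_add, hx, hy, add_zero]
  | smul t x _ hx => rw [smul_lie, map_smul, hx, smul_zero]

/-! ### Gauge transformations in low degree -/

section

variable {R} {m u : R.Series} {a : ℤ}

theorem seriesBracket_eq_sum (hm : ∀ n ≤ 0, m n = 0) (hu : ∀ n < a, u n = 0) (k : ℤ) :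
    R.seriesBracket m u k = ∑ n ∈ Finset.Icc 1 (k - a), ⁅m n, u (k - n)⁆ := by
  rw [seriesBracket]
  refine finsum_eq_sum_of_support_subset _ fun n hn => ?_
  rw [Finset.coe_Icc, Set.mem_Icc]
  by_contra hn'
  refine hn ?_
  by_cases h1 : n ≤ 0
  · simp only [hm n h1, zero_lie]
  · simp only [hu (k - n) (by omega), lie_zero]

theorem seriesBracket_eq_zero (hm : ∀ n ≤ 0, m n = 0) (hu : ∀ n < a, u n = 0) {k : ℤ}
    (hk : k < a + 1) : R.seriesBracket m u k = 0 := by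
  rw [seriesBracket_eq_sum hm hu, Finset.Icc_eq_empty (by omega), Finset.sum_empty]

theorem iterate_seriesBracket_eq_zero (hm : ∀ n ≤ 0, m n = 0) (hu : ∀ n < a, u n = 0) (k : ℕ) :
    ∀ n < a + k, ((R.seriesBracket m)^[k] u) n = 0 := by
  induction k with
  | zero => simpa using hu
  | succ k ih =>
    intro n hn
    rw [Function.iterate_succ_apply']
    exact seriesBracket_eq_zero hm ih (by push_cast at hn; omega)

theorem expAd_eq_sum (hm : ∀ n ≤ 0, m n = 0) (hu : ∀ n < a, u n = 0) {n : ℤ} {K : ℕ}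
    (hn : n < a + K) : R.expAd m u n =
      ∑ k ∈ Finset.range K, ((k.factorial : ℂ)⁻¹) • ((R.seriesBracket m)^[k] u) n := by
  rw [expAd]
  refine finsum_eq_sum_of_support_subset _ fun k hk => ?_
  rw [Finset.coe_range, Set.mem_Iio]
  by_contra hk'
  refine hk ?_
  simp only [iterate_seriesBracket_eq_zero hm hu k n (by omega), smul_zero]

theorem expLogDeriv_eq_sum (hm : ∀ n ≤ 0, m n = 0) {n : ℤ} {K : ℕ} (hn : n < 1 + K) :
    R.expLogDeriv m n = ∑ k ∈ Finset.range K,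
      (((k + 1).factorial : ℂ)⁻¹) • ((R.seriesBracket m)^[k] (R.seriesDeriv m)) n := by
  rw [expLogDeriv]
  refine finsum_eq_sum_of_support_subset _ fun k hk => ?_
  rw [Finset.coe_range, Set.mem_Iio]
  by_contra hk'
  refine hk ?_
  have hu : ∀ n < 1, R.seriesDeriv m n = 0 := fun n hn => by
    rw [seriesDeriv, hm n (by omega), map_zero]
  simp only [iterate_seriesBracket_eq_zero hm hu k n (by omega), smul_zero]

theorem gauge_zero (hm : ∀ n ≤ 0, m n = 0) (hu : ∀ n < -1, u n = 0) :
    R.gauge m u 0 = u 0 + ⁅m 1, u (-1)⁆ := by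
  -- `u` starts in degree -1 and each bracket with `m` raises the degree, so only k ≤ 1 reaches
  -- degree 0; the logarithmic derivative starts in degree 1.
  rw [gauge, Pi.sub_apply, expAd_eq_sum (K := 2) hm hu (by norm_num),
    expLogDeriv_eq_sum (K := 0) hm (by norm_num), Finset.sum_range_succ, Finset.sum_range_one,
    Finset.sum_range_zero, sub_zero, Function.iterate_one, seriesBracket_eq_sum hm hu]
  simp

theorem gauge_one (hm : ∀ n ≤ 0, m n = 0) (hu : ∀ n < -1, u n = 0) :
    R.gauge m u 1 = u 1 + (⁅m 1, u 0⁆ + ⁅m 2, u (-1)⁆) + (2 : ℂ)⁻¹ • ⁅m 1, ⁅m 1, u (-1)⁆⁆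
      - merDeriv.rTensor R.LDual (m 1) := by
  -- The single bracket starts in degree 0, so the double bracket in degree 1 involves only `m 1`.
  have hu1 : ∀ n < 0, R.seriesBracket m u n = 0 := fun n hn =>
    seriesBracket_eq_zero hm hu (by omega)
  rw [gauge, Pi.sub_apply, expAd_eq_sum (K := 3) hm hu (by norm_num),
    expLogDeriv_eq_sum (K := 1) hm (by norm_num), Finset.sum_range_succ, Finset.sum_range_succ,
    Finset.sum_range_one, Finset.sum_range_one, Function.iterate_one,
    Function.iterate_succ_apply', Function.iterate_one, seriesBracket_eq_sum hm hu,
    seriesBracket_eq_sum hm hu1, Finset.sum_congr (s₁ := Finset.Icc 1 (1 - 0)) (by simp; rfl)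
      (fun _ _ => rfl), Finset.sum_singleton, seriesBracket_eq_sum hm hu]
  have h2 : Finset.Icc (1 : ℤ) (1 - -1) = {1, 2} := by decide
  rw [h2, Finset.sum_pair (by norm_num)]
  simp [seriesDeriv]

end

/-! ### Extension of scalars to meromorphic functions -/

/-- The `ℳ`-linear extension of `cyclicFunctional`. -/
def merFunctional : Mer ⊗[ℂ] R.LDual →ₗ[Mer] Mer :=
  (TensorProduct.AlgebraTensorModule.rid ℂ Mer Mer).toLinearMap ∘ₗ
    R.cyclicFunctional.baseChange Mer

theorem merFunctional_tmul (x : Mer) (y : R.LDual) :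
    R.merFunctional (x ⊗ₜ y) = R.cyclicFunctional y • x := by
  simp [merFunctional]

/-- The `ℳ`-bilinear extension of the form `(·|·)` on `𝔥*`. -/
def merBilin : LinearMap.BilinForm Mer (Mer ⊗[ℂ] Dual ℂ 𝔥) := R.dualBilin.baseChange Mer

theorem merBilin_tmul (x y : Mer) (lam mu : Dual ℂ 𝔥) :
    R.merBilin (x ⊗ₜ lam) (y ⊗ₜ mu) = R.dualForm lam mu • (x * y) := by
  simp [merBilin, dualBilin_apply]

theorem merBilin_symm (x y : Mer ⊗[ℂ] Dual ℂ 𝔥) : R.merBilin x y = R.merBilin y x := by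
  induction x with
  | zero => simp
  | add x x' hx hx' => rw [map_add, LinearMap.add_apply, hx, hx', map_add]
  | tmul a lam =>
    induction y with
    | zero => simp
    | add y y' hy hy' => rw [map_add, map_add, LinearMap.add_apply, hy, hy']
    | tmul b mu => rw [merBilin_tmul, merBilin_tmul, R.dualForm_symm, mul_comm]

/-- The extension `ℳ ⊗ 𝔥* → ᴸ𝔤(ℳ)` of `cartanMap`. -/
def merCartan : Mer ⊗[ℂ] Dual ℂ 𝔥 →ₗ[Mer] Mer ⊗[ℂ] R.LDual := R.cartanMap.baseChange Mer

theorem merCartan_tmul (x : Mer) (lam : Dual ℂ 𝔥) :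
    R.merCartan (x ⊗ₜ lam) = x ⊗ₜ R.H lam := rfl

theorem merCartan_injective : Function.Injective R.merCartan :=
  Module.Flat.lTensor_preserves_injective_linearMap R.cartanMap R.H_injective

variable {R} {ρ : Dual ℂ 𝔥}

theorem merFunctional_lie_pNegOne (hρ : ∀ i, ρ (R.coroot i) = 1) {y : Mer ⊗[ℂ] R.LDual}
    (hy : y ∈ (R.graded 2).baseChange Mer) :
    R.merFunctional ⁅y, (1 : Mer) ⊗ₜ[ℂ] R.pNegOne⁆ = 0 := by
  rw [Submodule.baseChange_eq_span] at hy
  induction hy using Submodule.span_induction with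
  | mem y hy =>
    obtain ⟨y, hy, rfl⟩ := hy
    rw [TensorProduct.mk_apply, LieAlgebra.ExtendScalars.bracket_tmul, merFunctional_tmul,
      R.cyclicFunctional_lie_pNegOne hρ hy, zero_smul]
  | zero => simp
  | add x y _ _ hx hy => rw [add_lie, map_add, hx, hy, add_zero]
  | smul t x _ hx => rw [smul_lie, map_smul, hx, smul_zero]

theorem exists_eq_sum_E (hρ : ∀ i, ρ (R.coroot i) = 1) {y : Mer ⊗[ℂ] R.LDual}
    (hy : y ∈ (R.graded 1).baseChange Mer) :
    ∃ x : Fin (ℓ + 1) → Mer, y = ∑ i, x i ⊗ₜ[ℂ] R.E i := by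
  have hy' := Submodule.baseChange_mono Mer (graded_one_le hρ) hy
  rw [Submodule.baseChange_span, ← Set.range_comp, Submodule.mem_span_range_iff_exists_fun] at hy'
  obtain ⟨x, rfl⟩ := hy'
  refine ⟨x, Finset.sum_congr rfl fun i _ => ?_⟩
  rw [Function.comp_apply, TensorProduct.mk_apply, TensorProduct.smul_tmul', smul_eq_mul, mul_one]

theorem exists_eq_tmul_pOne (hρ : ∀ i, ρ (R.coroot i) = 1) {y : Mer ⊗[ℂ] R.LDual}
    (hy : y ∈ (R.principal 1).baseChange Mer) : ∃ v : Mer, y = v ⊗ₜ[ℂ] R.pOne := by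
  have hy' := Submodule.baseChange_mono Mer (principal_one_le hρ) hy
  rw [Submodule.baseChange_span, Set.image_singleton, Submodule.mem_span_singleton] at hy'
  obtain ⟨v, rfl⟩ := hy'
  refine ⟨v, ?_⟩
  rw [TensorProduct.mk_apply, TensorProduct.smul_tmul', smul_eq_mul, mul_one]

/-! ### The coefficient of p_1 for a connection with Cartan-valued part U -/

variable (R)

theorem lie_sum_E_pNegOne (x : Fin (ℓ + 1) → Mer) :
    ⁅∑ i, x i ⊗ₜ[ℂ] R.E i, (1 : Mer) ⊗ₜ[ℂ] R.pNegOne⁆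
      = R.merCartan (∑ i, x i ⊗ₜ[ℂ] R.root i) := by
  rw [sum_lie, map_sum]
  refine Finset.sum_congr rfl fun i _ => ?_
  rw [LieAlgebra.ExtendScalars.bracket_tmul, lie_E_pNegOne, mul_one, merCartan_tmul]

/-- From [ě_i, μ] = -⟨μ, α̌_i⟩ ě_i and (ǎ_i/a_i) ⟨μ, α̌_i⟩ = (α_i|μ). -/
theorem merFunctional_lie_merCartan (x : Fin (ℓ + 1) → Mer) (U : Mer ⊗[ℂ] Dual ℂ 𝔥) :
    R.merFunctional ⁅∑ i, x i ⊗ₜ[ℂ] R.E i, R.merCartan U⁆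
      = -R.merBilin (∑ i, x i ⊗ₜ[ℂ] R.root i) U := by
  induction U with
  | zero => simp
  | add U U' h h' => rw [map_add, lie_add, map_add, h, h', map_add, neg_add]
  | tmul a mu =>
    rw [merCartan_tmul, sum_lie, map_sum, map_sum, LinearMap.sum_apply, ← Finset.sum_neg_distrib]
    refine Finset.sum_congr rfl fun i _ => ?_
    rw [LieAlgebra.ExtendScalars.bracket_tmul, merBilin_tmul, merFunctional_tmul, ← lie_skew,
      R.lie_H_E, map_neg, map_smul, R.cyclicFunctional_E, R.dualForm_root, neg_smul, smul_eq_mul,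
      mul_comm (mu _)]

/-- The value ǎ_i/a_i of the functional at ě_i is also (α_i|ρ). -/
theorem merFunctional_deriv (hρ : ∀ i, ρ (R.coroot i) = 1) (x : Fin (ℓ + 1) → Mer) :
    R.merFunctional (merDeriv.rTensor R.LDual (∑ i, x i ⊗ₜ[ℂ] R.E i))
      = R.merBilin (merDeriv.rTensor _ (∑ i, x i ⊗ₜ[ℂ] R.root i)) (1 ⊗ₜ ρ) := by
  simp only [map_sum, LinearMap.rTensor_tmul, LinearMap.sum_apply, merBilin_tmul,
    merFunctional_tmul, R.dualForm_root, R.cyclicFunctional_E, hρ, mul_one]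

/-- The coefficient of `p_1` in a quasi-canonical form of `d + p_{-1} dz + U dz`, with `U` valued
in `ᴸ𝔥`, is `(½ (U|U) + (U'|ρ)) / h^∨`. -/
theorem exists_coefficient_pOne (hρ : R.IsRho ρ) (U : Mer ⊗[ℂ] Dual ℂ 𝔥) {m : R.Series}
    (hm : m ∈ R.nilHat) {φ : Mer}
    (hqc : R.IsQuasiCanonical ρ φ
      (R.gauge m (R.pNegOneSeries + (Pi.single 0 (R.merCartan U) : R.Series)))) :
    ∃ v : Mer, R.gauge m (R.pNegOneSeries + (Pi.single 0 (R.merCartan U) : R.Series)) 1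
        = v ⊗ₜ[ℂ] R.pOne ∧
      (C.dualCoxeter : Mer) * v
        = 2⁻¹ * R.merBilin U U + R.merBilin (merDeriv.rTensor _ U) (1 ⊗ₜ ρ) := by
  set A₀ : R.Series := R.pNegOneSeries + (Pi.single 0 (R.merCartan U) : R.Series) with hA₀
  have hneg : ∀ n < -1, A₀ n = 0 := fun n hn => by
    rw [hA₀, Pi.add_apply, pNegOneSeries, Pi.single_eq_of_ne (by omega),
      Pi.single_eq_of_ne (by omega), add_zero]
  have hA1 : A₀ (-1) = (1 : Mer) ⊗ₜ[ℂ] R.pNegOne := by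
    rw [hA₀, Pi.add_apply, pNegOneSeries, Pi.single_eq_same, Pi.single_eq_of_ne (by omega),
      add_zero]
  have hA2 : A₀ 0 = R.merCartan U := by
    rw [hA₀, Pi.add_apply, pNegOneSeries, Pi.single_eq_same, Pi.single_eq_of_ne (by omega),
      zero_add]
  have hA3 : A₀ 1 = 0 := by
    rw [hA₀, Pi.add_apply, pNegOneSeries, Pi.single_eq_of_ne (by omega),
      Pi.single_eq_of_ne (by omega), add_zero]
  obtain ⟨x, hx⟩ := exists_eq_sum_E hρ.coroot (hm.1 1)
  obtain ⟨a, ha, hqc⟩ := hqc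
  set Y : Mer ⊗[ℂ] Dual ℂ 𝔥 := ∑ i, x i ⊗ₜ[ℂ] R.root i with hY
  set q : Mer := φ / (C.dualCoxeter : Mer) with hq
  have h0 := gauge_zero hm.2 hneg
  rw [hA1, hA2, hx, R.lie_sum_E_pNegOne, ← hY, ← map_add, hqc] at h0
  rw [Pi.add_apply, Pi.sub_apply, pNegOneSeries, Pi.single_eq_of_ne (by omega), Pi.single_eq_same,
    ha.2 0 le_rfl, add_zero, zero_sub, ← merCartan_tmul, ← map_neg] at h0
  -- The degree 0 equation, pulled back along the injection of ℳ ⊗ 𝔥*.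
  have hYU : Y = -U - q ⊗ₜ ρ := by
    have := R.merCartan_injective h0
    rw [sub_eq_add_neg, this]
    abel
  have h1 := gauge_one hm.2 hneg
  rw [hA1, hA2, hA3, hx, R.lie_sum_E_pNegOne, ← hY, zero_add] at h1
  obtain ⟨v, hv⟩ := exists_eq_tmul_pOne hρ.coroot (ha.1 1 le_rfl)
  have h2 : R.gauge m A₀ 1 = v ⊗ₜ[ℂ] R.pOne := by
    rw [hqc, Pi.add_apply, Pi.sub_apply, pNegOneSeries, Pi.single_eq_of_ne (by omega),
      Pi.single_eq_of_ne (by omega), hv, sub_zero, zero_add]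
  refine ⟨v, h2, ?_⟩
  -- Applying the functional to degree 1 removes the unknown m_2 and leaves h^∨ v = -(Y|U) - ½ (Y|Y)
  -- - (Y'|ρ).
  have h3 := congrArg R.merFunctional (h2.symm.trans h1)
  rw [map_sub, map_add, map_add, LinearMap.map_smul_of_tower, R.merFunctional_lie_merCartan,
    R.merFunctional_lie_merCartan, merFunctional_lie_pNegOne hρ.coroot (hm.1 2),
    R.merFunctional_deriv hρ.coroot, ← hY, merFunctional_tmul, R.cyclicFunctional_pOne] at h3
  -- (ρ|ρ) = 0 removes the terms in q² and q'; those linear in q cancel by symmetry of the form.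
  have hr1 : R.merBilin (q ⊗ₜ ρ) (q ⊗ₜ ρ) = 0 := by rw [merBilin_tmul, hρ.self, zero_smul]
  have hr2 : R.merBilin (merDeriv.rTensor _ (q ⊗ₜ ρ)) (1 ⊗ₜ ρ) = 0 := by
    rw [LinearMap.rTensor_tmul, merBilin_tmul, hρ.self, zero_smul]
  have hs := R.merBilin_symm U (q ⊗ₜ ρ)
  rw [hYU] at h3
  simp only [map_sub, map_neg, LinearMap.sub_apply, LinearMap.neg_apply, hr1, hr2, hs] at h3
  rw [RatFunc.smul_eq_C_mul, RatFunc.smul_eq_C_mul, map_natCast, map_inv₀, map_ofNat] at h3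
  rw [h3]
  field_simp
  ring

end Realization

/-! ### Partial fractions -/

theorem X_sub_C_ne_zero (x : ℂ) : (RatFunc.X - RatFunc.C x : Mer) ≠ 0 := by
  have h : (RatFunc.X - RatFunc.C x : Mer)
      = algebraMap (Polynomial ℂ) Mer (Polynomial.X - Polynomial.C x) := by
    rw [map_sub, RatFunc.algebraMap_X, RatFunc.algebraMap_C]
  rw [h]
  exact RatFunc.algebraMap_ne_zero (Polynomial.X_sub_C_ne_zero x)

theorem merDeriv_simplePole (x : ℂ) : merDeriv (simplePole x) = -simplePole x ^ 2 := by
  have h : simplePole x = algebraMap (Polynomial ℂ) Mer 1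
      / algebraMap (Polynomial ℂ) Mer (Polynomial.X - Polynomial.C x) := by
    rw [map_one, map_sub, RatFunc.algebraMap_X, RatFunc.algebraMap_C, one_div, simplePole]
  have h2 : merDeriv (simplePole x) = merDerivFun (simplePole x) := rfl
  rw [h2, h, merDerivFun_div _ _ (Polynomial.X_sub_C_ne_zero x)]
  simp [div_eq_mul_inv]

theorem simplePole_mul_simplePole {x y : ℂ} (hxy : x ≠ y) :
    simplePole x * simplePole y = RatFunc.C (x - y)⁻¹ * (simplePole x - simplePole y) := by
  have h1 := X_sub_C_ne_zero x
  have h2 := X_sub_C_ne_zero y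
  have h3 : (RatFunc.C x - RatFunc.C y : Mer) ≠ 0 := by
    rw [← map_sub]
    exact (map_ne_zero _).2 (sub_ne_zero.2 hxy)
  rw [simplePole, simplePole, map_inv₀, map_sub]
  field_simp
  ring

/-- The partial fraction expansion of a quadratic expression in simple poles; the terms `b = a` of
the inner sum vanish, being divided by zero. -/
theorem sum_smul_simplePole_mul {ι : Type*} [Fintype ι] {p : ι → ℂ} (hp : Function.Injective p)
    (g : ι → ι → ℂ) (hg : ∀ a b, g a b = g b a) :
    ∑ a, ∑ b, g a b • (simplePole (p a) * simplePole (p b))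
      = ∑ a, RatFunc.C (g a a) * simplePole (p a) ^ 2
        + 2 * ∑ a, RatFunc.C (∑ b, g a b / (p a - p b)) * simplePole (p a) := by
  classical
  have hterm : ∀ a b, g a b • (simplePole (p a) * simplePole (p b))
      = (if a = b then RatFunc.C (g a a) * simplePole (p a) ^ 2 else 0)
        + (RatFunc.C (g a b / (p a - p b)) * simplePole (p a)
          + RatFunc.C (g b a / (p b - p a)) * simplePole (p b)) := by
    intro a b
    rw [RatFunc.smul_eq_C_mul]
    split_ifs with hab
    · subst hab
      simp [pow_two]
    · rw [simplePole_mul_simplePole (hp.ne hab), hg b a, ← neg_sub (p a) (p b), div_neg,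
        div_eq_mul_inv, map_neg, map_mul]
      ring
  simp only [hterm, Finset.sum_add_distrib]
  rw [Finset.sum_comm (f := fun a b => RatFunc.C (g b a / (p b - p a)) * simplePole (p b))]
  simp only [Finset.sum_ite_eq, Finset.mem_univ, if_true, map_sum, Finset.sum_mul]
  ring

/-! ### Derivatives of the master function -/

/-- A continuous local inverse of exp is differentiable, with derivative 1/exp(f x) = 1/x. -/
theorem IsLogBranchNear.hasDerivAt {f : ℂ → ℂ} {x : ℂ} (hf : IsLogBranchNear f x) (hx : x ≠ 0) :
    HasDerivAt f x⁻¹ x := by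
  have h := hf.self_of_nhds
  have he : HasDerivAt Complex.exp x (f x) := by
    conv => arg 2; rw [← h.2]
    exact Complex.hasDerivAt_exp _
  exact HasDerivAt.of_local_left_inverse h.1 he hx (hf.mono fun y hy => hy.2)

theorem hasDerivAt_update_apply {ι : Type*} [Fintype ι] [DecidableEq ι] (z : ι → ℂ) (k i : ι)
    (t : ℂ) : HasDerivAt (fun s => Function.update z k s i) (if i = k then 1 else 0) t := by
  by_cases h : i = k
  · subst h
    simp only [Function.update_self, if_true]
    exact hasDerivAt_id t
  · simp only [Function.update_of_ne h, if_neg h]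
    exact hasDerivAt_const t (z i)

theorem hasDerivAt_sum_log_pair {n : ℕ} {z : Fin n → ℂ} (hz : Function.Injective z)
    (g : Fin n → Fin n → ℂ) (hg : ∀ i j, g i j = g j i) (L : Fin n → Fin n → ℂ → ℂ)
    (hL : ∀ i j, i < j → IsLogBranchNear (L i j) (z i - z j)) (k : Fin n) :
    HasDerivAt (fun t => ∑ i, ∑ j ∈ Finset.Ioi i,
        g i j * L i j (Function.update z k t i - Function.update z k t j))
      (∑ j, g k j / (z k - z j)) (z k) := by
  have hterm : HasDerivAt (fun t => ∑ i, ∑ j ∈ Finset.Ioi i,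
        g i j * L i j (Function.update z k t i - Function.update z k t j))
      (∑ i, ∑ j ∈ Finset.Ioi i,
        g i j * ((z i - z j)⁻¹ * ((if i = k then 1 else 0) - (if j = k then 1 else 0)))) (z k) := by
    refine HasDerivAt.fun_sum fun i _ => HasDerivAt.fun_sum fun j hj => ?_
    rw [Finset.mem_Ioi] at hj
    refine HasDerivAt.const_mul _ ?_
    refine HasDerivAt.comp (h₂ := L i j) (z k) ?_
      ((hasDerivAt_update_apply z k i _).sub (hasDerivAt_update_apply z k j _))
    rw [Function.update_eq_self]
    exact (hL i j hj).hasDerivAt (sub_ne_zero.2 (hz.ne hj.ne))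
  refine hterm.congr_deriv (Eq.symm ?_)
  -- `h` is skew, with zero diagonal by division by zero. The pairs i < j with i = k and those with
  -- j = k therefore combine into the full row `k`.
  set h : Fin n → Fin n → ℂ := fun i j => g i j / (z i - z j) with hh
  have hskew : ∀ i j, h i j = -h j i := by
    intro i j
    simp only [hh]
    rw [hg i j, ← neg_sub (z j) (z i), div_neg]
  have hdiag : ∀ i, h i i = 0 := fun i => by simp [hh]
  have h1 : ∀ i j, g i j * ((z i - z j)⁻¹ * ((if i = k then 1 else 0) - (if j = k then 1 else 0)))
      = (if i = k then h i j else 0) + (if j = k then h j i else 0) := by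
    intro i j
    have h2 : g i j * ((z i - z j)⁻¹ *
        ((if i = k then 1 else 0) - (if j = k then 1 else 0)))
        = h i j * ((if i = k then 1 else 0) - (if j = k then 1 else 0)) := by
      simp only [hh, div_eq_mul_inv, mul_assoc]
    rw [h2, hskew j i]
    split_ifs <;> ring
  have hIoi : ∀ i : Fin n, Finset.Ioi i = Finset.univ.filter fun j => i < j := by
    intro i; ext j; simp
  simp only [h1, Finset.sum_add_distrib, hIoi, Finset.sum_filter]
  rw [Finset.sum_comm (f := fun i j => if i < j then (if j = k then h j i else 0) else 0)]
  have h3 : ∀ i j : Fin n, (if i < j then (if i = k then h i j else 0) else 0)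
      = if i = k then (if i < j then h i j else 0) else 0 := by
    intro i j; split_ifs <;> rfl
  have h4 : ∀ i j : Fin n, (if j < i then (if i = k then h i j else 0) else 0)
      = if i = k then (if j < i then h i j else 0) else 0 := by
    intro i j; split_ifs <;> rfl
  simp only [h3, h4, ← Finset.sum_add_distrib]
  have h5 : ∀ i, ∑ j, ((if i = k then (if i < j then h i j else 0) else 0)
      + (if i = k then (if j < i then h i j else 0) else 0)) = if i = k then ∑ j, h i j else 0 := by
    intro i
    split_ifs
    · refine Finset.sum_congr rfl fun j _ => ?_
      rcases lt_trichotomy i j with hij | hij | hij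
      · simp [hij, hij.not_gt]
      · simp [hij, hdiag]
      · simp [hij, hij.not_gt]
    · simp
  simp only [h5]
  simp [hh]

namespace Realization

variable {ℓ : ℕ} {C : AffineCartanMatrix ℓ} {𝔥 : Type*} [AddCommGroup 𝔥] [Module ℂ 𝔥]
  (R : Realization C 𝔥) {N m : ℕ} {z : Fin N → ℂ} {lam : Fin N → Dual ℂ 𝔥} {w : Fin m → ℂ}
  {c : Fin m → Fin (ℓ + 1)} {Φ : (Fin N → ℂ) → (Fin m → ℂ) → ℂ}

theorem IsMasterFunctionNear.deriv_left (hΦ : R.IsMasterFunctionNear z lam w c Φ)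
    (hz : Function.Injective z) (hzw : ∀ i j, z i ≠ w j) (k : Fin N) :
    deriv (fun t => Φ (Function.update z k t) w) (z k)
      = ∑ j, R.dualForm (lam k) (lam j) / (z k - z j)
        - ∑ j, R.dualForm (lam k) (R.root (c j)) / (z k - w j) := by
  obtain ⟨logZZ, logZW, logWW, hZZ, hZW, -, hΦ⟩ := hΦ
  have hcont : Filter.Tendsto (fun t => (Function.update z k t, w)) (𝓝 (z k)) (𝓝 (z, w)) := by
    have h : ContinuousAt (fun t => (Function.update z k t, w)) (z k) := by fun_prop
    rwa [ContinuousAt, Function.update_eq_self] at h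
  refine HasDerivAt.deriv (HasDerivAt.congr_of_eventuallyEq ?_ (hcont.eventually hΦ))
  simp only
  -- The last sum of Φ does not involve z.
  rw [← add_zero (_ - _)]
  refine HasDerivAt.add (HasDerivAt.sub ?_ ?_) (hasDerivAt_const _ _)
  · exact hasDerivAt_sum_log_pair hz _ (fun i j => R.dualForm_symm _ _) logZZ hZZ k
  · have hterm : HasDerivAt (fun t => ∑ i, ∑ j, R.dualForm (lam i) (R.root (c j)) *
        logZW i j (Function.update z k t i - w j))
        (∑ i, ∑ j, R.dualForm (lam i) (R.root (c j)) *
          ((z i - w j)⁻¹ * (if i = k then 1 else 0))) (z k) := by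
      refine HasDerivAt.fun_sum fun i _ => HasDerivAt.fun_sum fun j _ => ?_
      refine HasDerivAt.const_mul _ ?_
      refine HasDerivAt.comp (h₂ := logZW i j) (z k) ?_
        ((hasDerivAt_update_apply z k i _).sub_const _)
      rw [Function.update_eq_self]
      exact (hZW i j).hasDerivAt (sub_ne_zero.2 (hzw i j))
    refine hterm.congr_deriv (Eq.symm ?_)
    rw [Finset.sum_eq_single k (fun i _ hik => by simp [hik]) (by simp)]
    simp [div_eq_mul_inv]

theorem IsMasterFunctionNear.deriv_right (hΦ : R.IsMasterFunctionNear z lam w c Φ)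
    (hw : Function.Injective w) (hzw : ∀ i j, z i ≠ w j) (k : Fin m) :
    deriv (fun t => Φ z (Function.update w k t)) (w k)
      = ∑ i, R.dualForm (lam i) (R.root (c k)) / (z i - w k)
        + ∑ j, R.dualForm (R.root (c k)) (R.root (c j)) / (w k - w j) := by
  obtain ⟨logZZ, logZW, logWW, -, hZW, hWW, hΦ⟩ := hΦ
  have hcont : Filter.Tendsto (fun t => (z, Function.update w k t)) (𝓝 (w k)) (𝓝 (z, w)) := by
    have h : ContinuousAt (fun t => (z, Function.update w k t)) (w k) := by fun_prop
    rwa [ContinuousAt, Function.update_eq_self] at h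
  refine HasDerivAt.deriv (HasDerivAt.congr_of_eventuallyEq ?_ (hcont.eventually hΦ))
  simp only
  -- The first sum of Φ does not involve w; in the second, the sign of Φ and that of -w_k cancel.
  rw [← neg_neg (∑ i, _ / (z i - w k)), ← zero_sub]
  refine HasDerivAt.add (HasDerivAt.sub (hasDerivAt_const _ _) ?_) ?_
  · have hterm : HasDerivAt (fun t => ∑ i, ∑ j, R.dualForm (lam i) (R.root (c j)) *
        logZW i j (z i - Function.update w k t j))
        (∑ i, ∑ j, R.dualForm (lam i) (R.root (c j)) *
          ((z i - w j)⁻¹ * -(if j = k then 1 else 0))) (w k) := by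
      refine HasDerivAt.fun_sum fun i _ => HasDerivAt.fun_sum fun j _ => ?_
      refine HasDerivAt.const_mul _ ?_
      refine HasDerivAt.comp (h₂ := logZW i j) (w k) ?_
        ((hasDerivAt_update_apply w k j _).const_sub _)
      rw [Function.update_eq_self]
      exact (hZW i j).hasDerivAt (sub_ne_zero.2 (hzw i j))
    refine hterm.congr_deriv (Eq.symm ?_)
    rw [← Finset.sum_neg_distrib]
    refine Finset.sum_congr rfl fun i _ => ?_
    rw [Finset.sum_eq_single k (fun j _ hjk => by simp [hjk]) (by simp)]
    simp [div_eq_mul_inv]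
  · exact hasDerivAt_sum_log_pair hw _ (fun i j => R.dualForm_symm _ _) logWW hWW k

/-- The diagonal of the square gives ½ (μ|μ) and the derivative of 1/(z - p) gives -(μ|ρ), while the
cross terms split into simple poles. -/
theorem merBilin_sum_simplePole {ι : Type*} [Fintype ι] {p : ι → ℂ} (hp : Function.Injective p)
    (mu : ι → Dual ℂ 𝔥) (ρ : Dual ℂ 𝔥) :
    2⁻¹ * R.merBilin (∑ a, simplePole (p a) ⊗ₜ mu a) (∑ a, simplePole (p a) ⊗ₜ mu a)
        + R.merBilin (merDeriv.rTensor _ (∑ a, simplePole (p a) ⊗ₜ mu a)) (1 ⊗ₜ ρ)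
      = ∑ a, RatFunc.C (1 / 2 * R.dualForm (mu a) (mu a) - R.dualForm (mu a) ρ)
          * simplePole (p a) ^ 2
        + ∑ a, RatFunc.C (∑ b, R.dualForm (mu a) (mu b) / (p a - p b)) * simplePole (p a) := by
  have h1 : R.merBilin (∑ a, simplePole (p a) ⊗ₜ mu a) (∑ a, simplePole (p a) ⊗ₜ mu a)
      = ∑ a, ∑ b, R.dualForm (mu a) (mu b) • (simplePole (p a) * simplePole (p b)) := by
    simp only [map_sum, LinearMap.sum_apply, merBilin_tmul]
    exact Finset.sum_comm
  have h2 : R.merBilin (merDeriv.rTensor _ (∑ a, simplePole (p a) ⊗ₜ mu a)) (1 ⊗ₜ ρ)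
      = -∑ a, RatFunc.C (R.dualForm (mu a) ρ) * simplePole (p a) ^ 2 := by
    simp only [map_sum, LinearMap.sum_apply, LinearMap.rTensor_tmul, merBilin_tmul,
      merDeriv_simplePole, mul_one, RatFunc.smul_eq_C_mul, mul_neg, Finset.sum_neg_distrib]
  rw [h1, h2, sum_smul_simplePole_mul hp _ fun a b => R.dualForm_symm _ _]
  simp only [map_sub, sub_mul, Finset.sum_sub_distrib, map_mul, mul_assoc, ← Finset.mul_sum,
    one_div, map_inv₀, map_ofNat]
  ring

theorem dualForm_neg_left (x y : Dual ℂ 𝔥) : R.dualForm (-x) y = -R.dualForm x y := by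
  simp [← dualBilin_apply]

theorem dualForm_neg_right (x y : Dual ℂ 𝔥) : R.dualForm x (-y) = -R.dualForm x y := by
  simp [← dualBilin_apply]

theorem dualForm_add_two_smul (x y : Dual ℂ 𝔥) :
    R.dualForm x (x + (2 : ℂ) • y) = R.dualForm x x + 2 * R.dualForm x y := by
  simp [← dualBilin_apply]

theorem miura_eq (z : Fin N → ℂ) (lam : Fin N → Dual ℂ 𝔥) (w : Fin m → ℂ)
    (c : Fin m → Fin (ℓ + 1)) :
    R.miura z lam w c = R.pNegOneSeries + (Pi.single 0 (R.merCartan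
      (∑ a, simplePole (Sum.elim z w a) ⊗ₜ
        (Sum.elim (fun i => -lam i) (fun j => R.root (c j)) : Fin N ⊕ Fin m → Dual ℂ 𝔥) a)) :
      R.Series) := by
  rw [miura, Fintype.sum_sum_type, map_add, map_sum, map_sum]
  simp only [Sum.elim_inl, Sum.elim_inr, TensorProduct.tmul_neg, map_neg, merCartan_tmul,
    Finset.sum_neg_distrib]

theorem dualCoxeter_ne_zero (C : AffineCartanMatrix ℓ) : (C.dualCoxeter : Mer) ≠ 0 := by
  have h : 0 < C.dualCoxeter := Finset.sum_pos (fun i _ => C.comark_pos i) Finset.univ_nonempty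
  exact_mod_cast h.ne'

end Realization

end AffineOper

end

/-! ### The Miura oper: comparison of double poles and residues -/

theorem theorem4p6 {ℓ : ℕ} (C : AffineCartanMatrix ℓ)
    {𝔥 : Type*} [AddCommGroup 𝔥] [Module ℂ 𝔥] (R : Realization C 𝔥)
    (ρ : Module.Dual ℂ 𝔥) (hρ : R.IsRho ρ)
    {N m : ℕ} (z : Fin N → ℂ) (w : Fin m → ℂ)
    (hz : Function.Injective z) (hw : Function.Injective w) (hzw : ∀ i j, z i ≠ w j)
    (lam : Fin N → Module.Dual ℂ 𝔥) (c : Fin m → Fin (ℓ + 1))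
    -- a branch near `(z, w)` of the master function
    (Φ : (Fin N → ℂ) → (Fin m → ℂ) → ℂ) (hΦ : R.IsMasterFunctionNear z lam w c Φ)
    -- a quasi-canonical form of the oper underlying the Miura oper
    (φ : Mer) (A : R.Series) (hA : A ∈ R.oper (R.miura z lam w c))
    (hqc : R.IsQuasiCanonical ρ φ A) (v : Mer) :
    -- `v` is the coefficient of `p_1`
    A 1 = v ⊗ₜ[ℂ] R.pOne ↔
      v = (C.dualCoxeter : Mer)⁻¹ *
        (∑ i, RatFunc.C (1 / 2 * R.dualForm (lam i) (lam i + (2 : ℂ) • ρ)) * simplePole (z i) ^ 2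
          + ∑ i, RatFunc.C (deriv (fun t => Φ (Function.update z i t) w) (z i)) *
              simplePole (z i)
          + ∑ j, RatFunc.C (deriv (fun t => Φ z (Function.update w j t)) (w j)) *
              simplePole (w j)) := by
  obtain ⟨n, hn, rfl⟩ := hA
  rw [R.miura_eq] at hqc ⊢
  obtain ⟨v₀, h1, h2⟩ := R.exists_coefficient_pOne hρ _ hn hqc
  have hh := Realization.dualCoxeter_ne_zero C
  rw [h1]
  -- The coefficient of p_1 is unique, because the functional takes the nonzero value h^∨ on p_1.
  have hinj : v₀ ⊗ₜ[ℂ] R.pOne = v ⊗ₜ[ℂ] R.pOne ↔ v = v₀ := by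
    refine ⟨fun h => ?_, fun h => by rw [h]⟩
    have := congrArg R.merFunctional h
    rw [R.merFunctional_tmul, R.merFunctional_tmul, R.cyclicFunctional_pOne,
      RatFunc.smul_eq_C_mul, RatFunc.smul_eq_C_mul, map_natCast] at this
    exact (mul_left_cancel₀ hh this).symm
  have hv₀ := (eq_inv_mul_iff_mul_eq₀ hh).2 h2
  rw [hinj, hv₀, R.merBilin_sum_simplePole (hz.sumElim hw hzw)]
  refine Eq.congr_right (congrArg _ ?_)
  -- No double pole at w_j: both ½ (α_i|α_i) and (α_i|ρ) equal ǎ_i/a_i.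
  have hroot : ∀ j, 1 / 2 * R.dualForm (R.root (c j)) (R.root (c j))
      - R.dualForm (R.root (c j)) ρ = 0 := fun j => by
    rw [R.dualForm_root_self, R.dualForm_root, hρ.coroot]
    ring
  simp only [Fintype.sum_sum_type, Sum.elim_inl, Sum.elim_inr, hroot, map_zero, zero_mul,
    Finset.sum_const_zero, add_zero, ← add_assoc]
  congr 1
  · congr 1
    · refine Finset.sum_congr rfl fun i _ => ?_
      rw [R.dualForm_add_two_smul, R.dualForm_neg_left, R.dualForm_neg_left, R.dualForm_neg_right]
      congr 2
      ring
    · refine Finset.sum_congr rfl fun i _ => ?_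
      rw [hΦ.deriv_left R hz hzw i]
      simp only [R.dualForm_neg_left, R.dualForm_neg_right, neg_neg, neg_div,
        Finset.sum_neg_distrib, sub_eq_add_neg]
  · refine Finset.sum_congr rfl fun j _ => ?_
    rw [hΦ.deriv_right R hw hzw j]
    congr 3
    refine Finset.sum_congr rfl fun i _ => ?_
    rw [R.dualForm_neg_right, R.dualForm_symm, ← neg_sub (z i), neg_div_neg_eq]
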